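/- Let $R$ be a commutative noetherian ring, $F$ a free $R$-module of finite rank $n\ge 2$, $F^*=\operatorname{Hom}_R(F,R)$, $X\colon F\to F^*$ an $R$-linear map with dual $X^*\colon F\to F^*$, $X^*(a)(b)=X(b)(a)$, and $u,v\in F$. Each $\alpha\in F^*$ acts on $\bigwedge F$ as the graded derivation $$\alpha(a_1\wedge\dots\wedge a_s)=\sum_j(-1)^{j+1}\alpha(a_j)\,a_1\wedge\dots\wedge\widehat{a_j}\wedge\dots\wedge a_s ,$$ and this extends to a $\bigwedge F^*$-module structure on $\bigwedge F$, $(\alpha\wedge\beta)(a)=\alpha(\beta(a))$; in the same way $\bigwedge F^*$ is a $\bigwedge F$-module. Let $\eta\in\bigwedge^nF$ and $\varepsilon\in\bigwedge^nF^*$ be orientation elements with $\eta(\varepsilon)=1$. For $k\notin\{0,\dots,n\}$ we have $\bigwedge^k=0$. Co-multiplication $\Delta\colon\bigwedge F\to\bigwedge F\otimes\bigwedge F$ (and likewise for $F^*$) is the map of graded-commutative algebras with $\Delta(a)=a\otimes 1+1\otimes a$ for $a\in F$. For $x$ of degree $t$ write $\sum_j x_1^{[j]}\otimes x_{t-1}^{[j]}$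 for the component of $\Delta(x)$ of bidegree $(1,t-1)$. For $r\in\mathbb Z$ let $\mathbb F_r=\mathbb F_r(1)\oplus\mathbb F_r(2)\oplus\mathbb F_r(3)\oplus\mathbb F_r(4)$ with $\mathbb F_r(i)=\bigoplus_{t\in\mathbb Z}\mathbb F_r(i)^{(t)}$, where $$\mathbb F_r(1)^{(t)}=\textstyle\bigwedge^tF^*\otimes\bigwedge^{r+1-t}F^*,\quad \mathbb F_r(2)^{(t)}=\mathbb F_r(3)^{(t)}=\bigwedge^tF\otimes\bigwedge^{r-t}F^*,\quad \mathbb F_r(4)^{(t)}=\bigwedge^tF^*\otimes\bigwedge^{r-1-t}F^* .$$ Let $f_r\colon\mathbb F_r\to\mathbb F_{r-1}$ be the $R$-linear map given as follows, where $a_t\in\bigwedge^tF$, $\alpha_t\in\bigwedge^tF^*$ and $\beta_s\in\bigwedge^sF^*$. On $\mathbb F_r(1)^{(t)}$, with $s+t=r+1$, the image of $\alpha_t\otimes\beta_s$ is the sum of - $\alpha_t\otimes v(\beta_s)\in\mathbb F_{r-1}(1)^{(t)}$, - $(-1)^r\,u(\alpha_t)\otimes\beta_s\in\mathbb F_{r-1}(1)^{(t-1)}$,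 - $\sum_i\big[\beta_1^{[i]}\wedge(\bigwedge^{n-t}X^*)(\alpha_t[\eta])\big](\eta)\otimes\beta_{s-1}^{[i]}\in\mathbb F_{r-1}(2)^{(t-1)}$, - $\sum_j\big[\alpha_1^{[j]}\wedge(\bigwedge^{n-s}X)(\beta_s[\eta])\big](\eta)\otimes\alpha_{t-1}^{[j]}\in\mathbb F_{r-1}(3)^{(s-1)}$. On $\mathbb F_r(2)^{(t)}$, with $s+t=r$, the image of $a_t\otimes\beta_s$ is the sum of - $(-1)^r(\bigwedge^tX)(a_t)\otimes\beta_s\in\mathbb F_{r-1}(1)^{(t)}$, - $a_t\otimes v(\beta_s)\in\mathbb F_{r-1}(2)^{(t)}$, - $(-1)^{r+1}[X^*(u)](a_t)\otimes\beta_s\in\mathbb F_{r-1}(2)^{(t-1)}$, - $\sum_j(\bigwedge^{t-1}X)(a_{t-1}^{[j]})\otimes a_1^{[j]}(\beta_s)\in\mathbb F_{r-1}(4)^{(t-1)}$. On $\mathbb F_r(3)^{(t)}$, with $s+t=r$, the image of $a_t\otimes\beta_s$ is the sum of - $(-1)^{r+1}\beta_s\otimes(\bigwedge^tX^*)(a_t)\in\mathbb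 F_{r-1}(1)^{(s)}$, - $(-1)^{r+1}a_t\otimes u(\beta_s)\in\mathbb F_{r-1}(3)^{(t)}$, - $[X(v)](a_t)\otimes\beta_s\in\mathbb F_{r-1}(3)^{(t-1)}$, - $-\sum_ja_1^{[j]}(\beta_s)\otimes(\bigwedge^{t-1}X^*)(a_{t-1}^{[j]})\in\mathbb F_{r-1}(4)^{(s-1)}$. On $\mathbb F_r(4)^{(t)}$, with $s+t=r-1$, the image of $\alpha_t\otimes\beta_s$ is the sum of - $(-1)^r\big[(\bigwedge^{n-t}X^*)(\alpha_t[\eta])\big](\eta)\otimes\beta_s\in\mathbb F_{r-1}(2)^{(t)}$, - $(-1)^r\big[(\bigwedge^{n-s}X)(\beta_s[\eta])\big](\eta)\otimes\alpha_t\in\mathbb F_{r-1}(3)^{(s)}$, - $\alpha_t\otimes v(\beta_s)\in\mathbb F_{r-1}(4)^{(t)}$, - $(-1)^r\,u(\alpha_t)\otimes\beta_s\in\mathbb F_{r-1}(4)^{(t-1)}$. Then these modules and maps form a complex $$0\to\mathbb F_{2n+1}\to\dots\to\mathbb F_r\xrightarrow{f_r}\mathbb F_{r-1}\to\dots\to\mathbb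 F_{-1}\to0 ,$$ that is, $\mathbb F_r=0$ for $r<-1$ and for $r>2n+1$, and $f_{r-1}\circ f_r=0$ for all $r$. -/

import Mathlib

open scoped TensorProduct DirectSum

noncomputable section

namespace MergedKoszul

section ExteriorPowers

variable {R M N : Type*} [CommRing R] [AddCommGroup M] [Module R M] [AddCommGroup N] [Module R N]

variable (R M) in
/-- The exterior power `⋀ᵏ M` for an integer `k`, as a submodule of the exterior algebra;
it is zero for negative `k`. -/
def ExtPow : ℤ → Submodule R (ExteriorAlgebra R M)
  | Int.ofNat k => ⋀[R]^k M
  | Int.negSucc _ => ⊥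

theorem mem_ExtPow_natCast {k : ℕ} {x : ExteriorAlgebra R M} :
    x ∈ ExtPow R M (k : ℤ) ↔ x ∈ ⋀[R]^k M := Iff.rfl

/-- The action of a functional on the exterior algebra as a graded derivation extends to the action
of the whole exterior algebra, `(α ∧ β)(x) = α(β(x))`.  The pairing `B` says how the elements of
`M` act as functionals on `N`: it is the identity for the action of `⋀ F*` on `⋀ F`, and the
evaluation map `F → F**` for the action of `⋀ F` on `⋀ F*`. -/
def act (B : M →ₗ[R] Module.Dual R N) :
    ExteriorAlgebra R M →ₐ[R] Module.End R (ExteriorAlgebra R N) :=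
  ExteriorAlgebra.lift R
    ⟨(CliffordAlgebra.contractLeft (Q := (0 : QuadraticForm R N))) ∘ₗ B, fun m =>
      LinearMap.ext fun x => CliffordAlgebra.contractLeft_contractLeft (B m) x⟩

theorem act_ι (B : M →ₗ[R] Module.Dual R N) (m : M) (x : ExteriorAlgebra R N) :
    act B (ExteriorAlgebra.ι R m) x =
      CliffordAlgebra.contractLeft (Q := (0 : QuadraticForm R N)) (B m) x := by
  simp [act]

theorem mul_mem_Pow {i j k : ℤ} (h : k = i + j) {x y : ExteriorAlgebra R M}
    (hx : x ∈ ExtPow R M i) (hy : y ∈ ExtPow R M j) : x * y ∈ ExtPow R M k := by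
  subst h
  rcases i with i | i
  · rcases j with j | j
    · change x * y ∈ ⋀[R]^(i + j) M
      exact SetLike.GradedMul.mul_mem (A := fun i : ℕ => ⋀[R]^i M) hx hy
    · rw [show y = 0 from hy, mul_zero]; exact zero_mem _
  · rw [show x = 0 from hx, zero_mul]; exact zero_mem _

theorem map_mem_Pow (f : M →ₗ[R] N) {k : ℤ} {x : ExteriorAlgebra R M} (hx : x ∈ ExtPow R M k) :
    ExteriorAlgebra.map f x ∈ ExtPow R N k := by
  rcases k with k | k
  · change x ∈ ⋀[R]^k M at hx
    change _ ∈ ⋀[R]^k N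
    have h := Submodule.mem_map_of_mem (f := (ExteriorAlgebra.map f).toLinearMap) hx
    rw [Submodule.map_pow] at h
    have hle : Submodule.map (ExteriorAlgebra.map f).toLinearMap
        (LinearMap.range (ExteriorAlgebra.ι R : M →ₗ[R] _)) ≤
        LinearMap.range (ExteriorAlgebra.ι R : N →ₗ[R] _) := by
      rintro _ ⟨_, ⟨m, rfl⟩, rfl⟩
      exact ⟨f m, by simp⟩
    exact pow_le_pow_left' hle k h
  · rw [show x = 0 from hx, map_zero]; exact zero_mem _

theorem contract_mem_Pow (d : Module.Dual R N) {j k : ℤ} (h : k = j - 1) {x : ExteriorAlgebra R N}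
    (hx : x ∈ ExtPow R N j) :
    CliffordAlgebra.contractLeft (Q := (0 : QuadraticForm R N)) d x ∈ ExtPow R N k := by
  subst h
  rcases j with j | j
  · change x ∈ ⋀[R]^j N at hx
    induction hx using Submodule.pow_induction_on_left' with
    | algebraMap r =>
      rw [show CliffordAlgebra.contractLeft (Q := (0 : QuadraticForm R N)) d
        (algebraMap R (ExteriorAlgebra R N) r) = 0 from
        CliffordAlgebra.contractLeft_algebraMap _ d r]
      exact zero_mem _
    | add x y i hx hy ihx ihy => rw [map_add]; exact add_mem ihx ihy
    | mem_mul m hm i x hx ih =>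
      obtain ⟨m, rfl⟩ := hm
      have e := CliffordAlgebra.contractLeft_ι_mul (Q := (0 : QuadraticForm R N)) (d := d) m x
      refine Eq.mpr (congrArg (· ∈ _) e) (sub_mem (Submodule.smul_mem _ _ ?_) ?_)
      · have : Int.ofNat i.succ - 1 = (i : ℤ) := by simp
        rw [this]; exact hx
      · refine mul_mem_Pow (i := 1) (j := Int.ofNat i - 1) ?_ ?_ ih
        · simp
        · change _ ∈ ⋀[R]^1 N
          rw [ExteriorAlgebra.exteriorPower, pow_one]; exact ⟨m, rfl⟩
  · rw [show x = 0 from hx, map_zero]; exact zero_mem _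

theorem act_mem_Pow (B : M →ₗ[R] Module.Dual R N) {i j k : ℤ} (h : k = j - i)
    {α : ExteriorAlgebra R M} {x : ExteriorAlgebra R N}
    (hα : α ∈ ExtPow R M i) (hx : x ∈ ExtPow R N j) : act B α x ∈ ExtPow R N k := by
  rcases i with i | i
  · change α ∈ ⋀[R]^i M at hα
    induction hα using Submodule.pow_induction_on_left' generalizing k with
    | algebraMap r =>
      rw [AlgHom.commutes, Module.algebraMap_end_apply]
      rw [show k = j by simpa using h]
      exact Submodule.smul_mem _ _ hx
    | add α β i hα hβ ihα ihβ =>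
      rw [map_add, LinearMap.add_apply]; exact add_mem (ihα h) (ihβ h)
    | mem_mul m hm i α hα ih =>
      obtain ⟨m, rfl⟩ := hm
      rw [map_mul, Module.End.mul_apply, act_ι]
      refine contract_mem_Pow (j := j - Int.ofNat i) (B m) ?_ (ih rfl)
      rw [h]; simp only [Int.ofNat_eq_natCast]; push_cast; ring
  · rw [show α = 0 from hα, map_zero]; exact zero_mem _

/-- The identity map `⋀ᵏ M → ⋀ˡ M` for `k = l`. -/
def castPow {k l : ℤ} (h : k = l) : ExtPow R M k →ₗ[R] ExtPow R M l :=
  Submodule.inclusion (le_of_eq (congrArg (ExtPow R M) h))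

/-- Restriction of a bilinear map to submodules. -/
def restrict₂ {A B C : Type*} [AddCommGroup A] [Module R A] [AddCommGroup B] [Module R B]
    [AddCommGroup C] [Module R C] (g : A →ₗ[R] B →ₗ[R] C) {P : Submodule R A} {Q : Submodule R B}
    {S : Submodule R C} (h : ∀ x ∈ P, ∀ y ∈ Q, g x y ∈ S) : P →ₗ[R] Q →ₗ[R] S :=
  LinearMap.mk₂ R (fun x y => ⟨g x y, h x x.2 y y.2⟩)
    (fun _ _ _ => Subtype.ext (by simp)) (fun _ _ _ => Subtype.ext (by simp))
    (fun _ _ _ => Subtype.ext (by simp)) (fun _ _ _ => Subtype.ext (by simp))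

/-- `⋀ⁱ M × ⋀ʲ N → ⋀ʲ⁻ⁱ N`, `(α, x) ↦ α(x)`. -/
def actPow (B : M →ₗ[R] Module.Dual R N) (i j k : ℤ) (h : k = j - i) :
    ExtPow R M i →ₗ[R] ExtPow R N j →ₗ[R] ExtPow R N k :=
  restrict₂ (act B).toLinearMap fun _ hx _ hy => act_mem_Pow B h hx hy

/-- `⋀ʲ N → ⋀ʲ⁻¹ N`, `x ↦ d(x)`, for a functional `d` on `N`. -/
def contractPow (d : Module.Dual R N) (j : ℤ) : ExtPow R N j →ₗ[R] ExtPow R N (j - 1) :=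
  (CliffordAlgebra.contractLeft (Q := (0 : QuadraticForm R N)) d).restrict
    fun _ hx => contract_mem_Pow d rfl hx

/-- `⋀ⁱ M × ⋀ʲ M → ⋀ⁱ⁺ʲ M`, `(x, y) ↦ x ∧ y`. -/
def wedgePow (i j k : ℤ) (h : k = i + j) : ExtPow R M i →ₗ[R] ExtPow R M j →ₗ[R] ExtPow R M k :=
  restrict₂ (LinearMap.mul R (ExteriorAlgebra R M)) fun _ hx _ hy => mul_mem_Pow h hx hy

/-- `⋀ᵏ f : ⋀ᵏ M → ⋀ᵏ N`. -/
def mapPow (f : M →ₗ[R] N) (k : ℤ) : ExtPow R M k →ₗ[R] ExtPow R N k :=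
  (ExteriorAlgebra.map f).toLinearMap.restrict fun _ hx => map_mem_Pow f hx

theorem comul_aux (m : M) :
    ((ExteriorAlgebra.ι R m) ᵍ⊗ₜ[R] 1 + 1 ᵍ⊗ₜ[R] (ExteriorAlgebra.ι R m) :
        (fun i : ℕ => ⋀[R]^i M) ᵍ⊗[R] (fun i : ℕ => ⋀[R]^i M)) *
      ((ExteriorAlgebra.ι R m) ᵍ⊗ₜ[R] 1 + 1 ᵍ⊗ₜ[R] (ExteriorAlgebra.ι R m)) = 0 := by
  have hm : ExteriorAlgebra.ι R m ∈ ⋀[R]^1 M := by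
    rw [ExteriorAlgebra.exteriorPower, pow_one]; exact ⟨m, rfl⟩
  have h1 := GradedTensorProduct.tmul_one_mul_coe_tmul (R := R) (fun i : ℕ => ⋀[R]^i M)
    (fun i : ℕ => ⋀[R]^i M) (ExteriorAlgebra.ι R m) ⟨_, hm⟩ 1
  have h2 := GradedTensorProduct.tmul_coe_mul_one_tmul (R := R) (fun i : ℕ => ⋀[R]^i M)
    (fun i : ℕ => ⋀[R]^i M) 1 ⟨_, hm⟩ (ExteriorAlgebra.ι R m)
  have h3 := GradedTensorProduct.tmul_one_mul_one_tmul (R := R) (fun i : ℕ => ⋀[R]^i M)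
    (fun i : ℕ => ⋀[R]^i M) (ExteriorAlgebra.ι R m) (ExteriorAlgebra.ι R m)
  have h4 := GradedTensorProduct.tmul_coe_mul_coe_tmul (R := R) (fun i : ℕ => ⋀[R]^i M)
    (fun i : ℕ => ⋀[R]^i M) 1 ⟨_, hm⟩ ⟨_, hm⟩ 1
  simp only [ExteriorAlgebra.ι_sq_zero, mul_one, one_mul, uzpow_one, Units.neg_smul, one_smul] at h1 h2 h3 h4
  rw [mul_add, add_mul, add_mul, h1, h2, h3, h4]
  simp [GradedTensorProduct.tmul]

variable (R M) in
/-- Co-multiplication `⋀ M → ⋀ M ⊗ ⋀ M`: the map of (graded commutative) algebras with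
`m ↦ m ⊗ 1 + 1 ⊗ m`, where `ᵍ⊗` is the tensor product with the multiplication
`(a ⊗ b)(a' ⊗ b') = (-1)^(deg b * deg a') aa' ⊗ bb'`. -/
def comul : ExteriorAlgebra R M →ₐ[R]
    (fun i : ℕ => ⋀[R]^i M) ᵍ⊗[R] (fun i : ℕ => ⋀[R]^i M) :=
  ExteriorAlgebra.lift R
    ⟨(GradedTensorProduct.includeLeft (R := R) (fun i : ℕ => ⋀[R]^i M)
        (fun i : ℕ => ⋀[R]^i M)).toLinearMap ∘ₗ ExteriorAlgebra.ι R +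
      (GradedTensorProduct.includeRight (R := R) (fun i : ℕ => ⋀[R]^i M)
        (fun i : ℕ => ⋀[R]^i M)).toLinearMap ∘ₗ ExteriorAlgebra.ι R,
      fun m => comul_aux m⟩

variable (R M) in
/-- The projection `⋀ M → ⋀ᵏ M`. -/
def projPow : (k : ℤ) → ExteriorAlgebra R M →ₗ[R] ExtPow R M k
  | Int.ofNat k => DirectSum.component R ℕ (fun i => ⋀[R]^i M) k ∘ₗ
      (DirectSum.decomposeLinearEquiv (fun i : ℕ => ⋀[R]^i M)).toLinearMap
  | Int.negSucc _ => 0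

/-- The component `⋀ᵗ M → ⋀ M → ⋀ M ⊗ ⋀ M → ⋀ᵖ M ⊗ ⋀^q M` of co-multiplication. -/
def comulPow (t p q : ℤ) : ExtPow R M t →ₗ[R] ExtPow R M p ⊗[R] ExtPow R M q :=
  TensorProduct.map (projPow R M p) (projPow R M q) ∘ₗ
    (GradedTensorProduct.of R (fun i : ℕ => ⋀[R]^i M)
      (fun i : ℕ => ⋀[R]^i M)).symm.toLinearMap ∘ₗ
    (comul R M).toLinearMap ∘ₗ (ExtPow R M t).subtype

end ExteriorPowers

section Complex

variable {R F : Type*} [CommRing R] [AddCommGroup F] [Module R F]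

/-- `⋀ᵗ F* → ⋀ⁿ⁻ᵗ F`, `α ↦ α[η]`. -/
def onTop {n : ℕ} (η : ⋀[R]^n F) (t k : ℤ) (h : k = n - t) :
    ExtPow R (Module.Dual R F) t →ₗ[R] ExtPow R F k :=
  (actPow LinearMap.id t n k h).flip ⟨η, η.2⟩

/-- `⋀ᵗ F* → ⋀ᵗ F`, `α ↦ [(⋀ⁿ⁻ᵗ Y)(α[η])](η)`. -/
def minor {n : ℕ} (η : ⋀[R]^n F) (Y : F →ₗ[R] Module.Dual R F) (t : ℤ) :
    ExtPow R (Module.Dual R F) t →ₗ[R] ExtPow R F t :=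
  onTop η (n - t) t (by ring) ∘ₗ mapPow Y (n - t) ∘ₗ onTop η t (n - t) rfl

/-- `⋀ᵗ F* × ⋀¹ F* → ⋀ᵗ⁻¹ F`, `(α, β) ↦ [β ∧ (⋀ⁿ⁻ᵗ Y)(α[η])](η)`. -/
def minorWedge {n : ℕ} (η : ⋀[R]^n F) (Y : F →ₗ[R] Module.Dual R F) (t : ℤ) :
    ExtPow R (Module.Dual R F) t →ₗ[R] ExtPow R (Module.Dual R F) 1 →ₗ[R] ExtPow R F (t - 1) :=
  ((wedgePow 1 (n - t) (1 + (n - t)) rfl).flip ∘ₗ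
    mapPow Y (n - t) ∘ₗ onTop η t (n - t) rfl).compr₂ (onTop η (1 + (n - t)) (t - 1) (by ring))

/-- `⋀ᵗ F* ⊗ ⋀ˢ F* → ⋀ᵗ⁻¹ F ⊗ ⋀ˢ⁻¹ F*`,
`α ⊗ β ↦ ∑ᵢ [β₁ⁱ ∧ (⋀ⁿ⁻ᵗ Y)(α[η])](η) ⊗ β'ⁱ`, where `∑ᵢ β₁ⁱ ⊗ β'ⁱ` is the component of `Δ(β)` in
`⋀¹ F* ⊗ ⋀ˢ⁻¹ F*`. -/
def minorComul {n : ℕ} (η : ⋀[R]^n F) (Y : F →ₗ[R] Module.Dual R F) (t s : ℤ) :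
    ExtPow R (Module.Dual R F) t ⊗[R] ExtPow R (Module.Dual R F) s →ₗ[R]
      ExtPow R F (t - 1) ⊗[R] ExtPow R (Module.Dual R F) (s - 1) :=
  TensorProduct.map (TensorProduct.lift (minorWedge η Y t)) LinearMap.id ∘ₗ
    (TensorProduct.assoc R _ _ _).symm.toLinearMap ∘ₗ
    TensorProduct.map LinearMap.id (comulPow s 1 (s - 1))

/-- `⋀ᵗ F ⊗ ⋀ˢ F* → ⋀ᵗ⁻¹ F* ⊗ ⋀ˢ⁻¹ F*`, `a ⊗ β ↦ ∑ⱼ (⋀ᵗ⁻¹ Y)(a'ʲ) ⊗ a₁ʲ(β)`, where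
`∑ⱼ a₁ʲ ⊗ a'ʲ` is the component of `Δ(a)` in `⋀¹ F ⊗ ⋀ᵗ⁻¹ F`. -/
def mapComul (Y : F →ₗ[R] Module.Dual R F) (t s : ℤ) :
    ExtPow R F t ⊗[R] ExtPow R (Module.Dual R F) s →ₗ[R]
      ExtPow R (Module.Dual R F) (t - 1) ⊗[R] ExtPow R (Module.Dual R F) (s - 1) :=
  TensorProduct.map (mapPow Y (t - 1))
      (TensorProduct.lift (actPow (Module.Dual.eval R F) 1 s (s - 1) rfl)) ∘ₗ
    (TensorProduct.assoc R _ _ _).toLinearMap ∘ₗ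
    TensorProduct.map ((TensorProduct.comm R _ _).toLinearMap ∘ₗ comulPow t 1 (t - 1))
      LinearMap.id

variable (R F) in
/-- `𝔽ᵣ(1) = ⨁ₜ ⋀ᵗ F* ⊗ ⋀ʳ⁺¹⁻ᵗ F*`. -/
def F1 (r : ℤ) : Type _ :=
  ⨁ t : ℤ, ExtPow R (Module.Dual R F) t ⊗[R] ExtPow R (Module.Dual R F) (r + 1 - t)

instance (r : ℤ) : AddCommMonoid (F1 R F r) :=
  inferInstanceAs (AddCommMonoid
    (⨁ t : ℤ, ExtPow R (Module.Dual R F) t ⊗[R] ExtPow R (Module.Dual R F) (r + 1 - t)))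

instance (r : ℤ) : Module R (F1 R F r) :=
  inferInstanceAs (Module R
    (⨁ t : ℤ, ExtPow R (Module.Dual R F) t ⊗[R] ExtPow R (Module.Dual R F) (r + 1 - t)))

variable (R F) in
/-- `𝔽ᵣ(2) = ⨁ₜ ⋀ᵗ F ⊗ ⋀ʳ⁻ᵗ F*`. -/
def F2 (r : ℤ) : Type _ :=
  ⨁ t : ℤ, ExtPow R F t ⊗[R] ExtPow R (Module.Dual R F) (r - t)

instance (r : ℤ) : AddCommMonoid (F2 R F r) :=
  inferInstanceAs (AddCommMonoid
    (⨁ t : ℤ, ExtPow R F t ⊗[R] ExtPow R (Module.Dual R F) (r - t)))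

instance (r : ℤ) : Module R (F2 R F r) :=
  inferInstanceAs (Module R
    (⨁ t : ℤ, ExtPow R F t ⊗[R] ExtPow R (Module.Dual R F) (r - t)))

variable (R F) in
/-- `𝔽ᵣ(3) = ⨁ₜ ⋀ᵗ F ⊗ ⋀ʳ⁻ᵗ F*`. -/
def F3 (r : ℤ) : Type _ :=
  ⨁ t : ℤ, ExtPow R F t ⊗[R] ExtPow R (Module.Dual R F) (r - t)

instance (r : ℤ) : AddCommMonoid (F3 R F r) :=
  inferInstanceAs (AddCommMonoid
    (⨁ t : ℤ, ExtPow R F t ⊗[R] ExtPow R (Module.Dual R F) (r - t)))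

instance (r : ℤ) : Module R (F3 R F r) :=
  inferInstanceAs (Module R
    (⨁ t : ℤ, ExtPow R F t ⊗[R] ExtPow R (Module.Dual R F) (r - t)))

variable (R F) in
/-- `𝔽ᵣ(4) = ⨁ₜ ⋀ᵗ F* ⊗ ⋀ʳ⁻¹⁻ᵗ F*`. -/
def F4 (r : ℤ) : Type _ :=
  ⨁ t : ℤ, ExtPow R (Module.Dual R F) t ⊗[R] ExtPow R (Module.Dual R F) (r - 1 - t)

instance (r : ℤ) : AddCommMonoid (F4 R F r) :=
  inferInstanceAs (AddCommMonoid
    (⨁ t : ℤ, ExtPow R (Module.Dual R F) t ⊗[R] ExtPow R (Module.Dual R F) (r - 1 - t)))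

instance (r : ℤ) : Module R (F4 R F r) :=
  inferInstanceAs (Module R
    (⨁ t : ℤ, ExtPow R (Module.Dual R F) t ⊗[R] ExtPow R (Module.Dual R F) (r - 1 - t)))

variable (R F) in
/-- `𝔽ᵣ = 𝔽ᵣ(1) ⊕ 𝔽ᵣ(2) ⊕ 𝔽ᵣ(3) ⊕ 𝔽ᵣ(4)`. -/
abbrev FF (r : ℤ) : Type _ := F1 R F r × F2 R F r × F3 R F r × F4 R F r

/-- The inclusion of `𝔽ᵣ(1)⁽ᵗ⁾ = ⋀ᵗ F* ⊗ ⋀ˢ F*`, `s + t = r + 1`, in `𝔽ᵣ(1)`. -/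
def of1 (r t s : ℤ) (h : s + t = r + 1) :
    ExtPow R (Module.Dual R F) t ⊗[R] ExtPow R (Module.Dual R F) s →ₗ[R] F1 R F r :=
  DirectSum.lof R ℤ
      (fun t => ExtPow R (Module.Dual R F) t ⊗[R] ExtPow R (Module.Dual R F) (r + 1 - t)) t ∘ₗ
    TensorProduct.map LinearMap.id (castPow (eq_sub_of_add_eq h))

/-- The inclusion of `𝔽ᵣ(1)⁽ᵗ⁾ = ⋀ᵗ F* ⊗ ⋀ˢ F*`, `s + t = r + 1`, in `𝔽ᵣ`. -/
def in1 (r t s : ℤ) (h : s + t = r + 1) :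
    ExtPow R (Module.Dual R F) t ⊗[R] ExtPow R (Module.Dual R F) s →ₗ[R] FF R F r :=
  LinearMap.inl R (F1 R F r) (F2 R F r × F3 R F r × F4 R F r) ∘ₗ of1 r t s h

/-- The inclusion of `𝔽ᵣ(2)⁽ᵗ⁾ = ⋀ᵗ F ⊗ ⋀ˢ F*`, `s + t = r`, in `𝔽ᵣ(2)`. -/
def of2 (r t s : ℤ) (h : s + t = r) :
    ExtPow R F t ⊗[R] ExtPow R (Module.Dual R F) s →ₗ[R] F2 R F r :=
  DirectSum.lof R ℤ
      (fun t => ExtPow R F t ⊗[R] ExtPow R (Module.Dual R F) (r - t)) t ∘ₗ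
    TensorProduct.map LinearMap.id (castPow (eq_sub_of_add_eq h))

/-- The inclusion of `𝔽ᵣ(2)⁽ᵗ⁾ = ⋀ᵗ F ⊗ ⋀ˢ F*`, `s + t = r`, in `𝔽ᵣ`. -/
def in2 (r t s : ℤ) (h : s + t = r) :
    ExtPow R F t ⊗[R] ExtPow R (Module.Dual R F) s →ₗ[R] FF R F r :=
  LinearMap.inr R (F1 R F r) (F2 R F r × F3 R F r × F4 R F r) ∘ₗ
    LinearMap.inl R (F2 R F r) (F3 R F r × F4 R F r) ∘ₗ of2 r t s h

/-- The inclusion of `𝔽ᵣ(3)⁽ᵗ⁾ = ⋀ᵗ F ⊗ ⋀ˢ F*`, `s + t = r`, in `𝔽ᵣ(3)`. -/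
def of3 (r t s : ℤ) (h : s + t = r) :
    ExtPow R F t ⊗[R] ExtPow R (Module.Dual R F) s →ₗ[R] F3 R F r :=
  DirectSum.lof R ℤ
      (fun t => ExtPow R F t ⊗[R] ExtPow R (Module.Dual R F) (r - t)) t ∘ₗ
    TensorProduct.map LinearMap.id (castPow (eq_sub_of_add_eq h))

/-- The inclusion of `𝔽ᵣ(3)⁽ᵗ⁾ = ⋀ᵗ F ⊗ ⋀ˢ F*`, `s + t = r`, in `𝔽ᵣ`. -/
def in3 (r t s : ℤ) (h : s + t = r) :
    ExtPow R F t ⊗[R] ExtPow R (Module.Dual R F) s →ₗ[R] FF R F r :=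
  LinearMap.inr R (F1 R F r) (F2 R F r × F3 R F r × F4 R F r) ∘ₗ
    LinearMap.inr R (F2 R F r) (F3 R F r × F4 R F r) ∘ₗ
    LinearMap.inl R (F3 R F r) (F4 R F r) ∘ₗ of3 r t s h

/-- The inclusion of `𝔽ᵣ(4)⁽ᵗ⁾ = ⋀ᵗ F* ⊗ ⋀ˢ F*`, `s + t = r - 1`, in `𝔽ᵣ(4)`. -/
def of4 (r t s : ℤ) (h : s + t = r - 1) :
    ExtPow R (Module.Dual R F) t ⊗[R] ExtPow R (Module.Dual R F) s →ₗ[R] F4 R F r :=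
  DirectSum.lof R ℤ
      (fun t => ExtPow R (Module.Dual R F) t ⊗[R] ExtPow R (Module.Dual R F) (r - 1 - t)) t ∘ₗ
    TensorProduct.map LinearMap.id (castPow (eq_sub_of_add_eq h))

/-- The inclusion of `𝔽ᵣ(4)⁽ᵗ⁾ = ⋀ᵗ F* ⊗ ⋀ˢ F*`, `s + t = r - 1`, in `𝔽ᵣ`. -/
def in4 (r t s : ℤ) (h : s + t = r - 1) :
    ExtPow R (Module.Dual R F) t ⊗[R] ExtPow R (Module.Dual R F) s →ₗ[R] FF R F r :=
  LinearMap.inr R (F1 R F r) (F2 R F r × F3 R F r × F4 R F r) ∘ₗ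
    LinearMap.inr R (F2 R F r) (F3 R F r × F4 R F r) ∘ₗ
    LinearMap.inr R (F3 R F r) (F4 R F r) ∘ₗ of4 r t s h

variable (R) in
/-- The sign `(-1)ʳ` in `R`. -/
def sgn (r : ℤ) : R := (((r.negOnePow : ℤˣ) : ℤ) : R)

variable {n : ℕ} (u : F) (X : F →ₗ[R] Module.Dual R F) (v : F) (η : ⋀[R]^n F)

/-- `⋀ʲ F* → ⋀ʲ⁻¹ F*`, `α ↦ w(α)`, for an element `w` of `F`. -/
def evalPow (w : F) (j : ℤ) : ExtPow R (Module.Dual R F) j →ₗ[R] ExtPow R (Module.Dual R F) (j - 1) :=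
  contractPow (Module.Dual.eval R F w) j

/-- The map `fᵣ(1)⁽ᵗ⁾` on `⋀ᵗ F* ⊗ ⋀ˢ F*`, `s + t = r + 1`. -/
def f1 (r t s : ℤ) (h : s + t = r + 1) :
    ExtPow R (Module.Dual R F) t ⊗[R] ExtPow R (Module.Dual R F) s →ₗ[R] FF R F (r - 1) :=
  in1 (R := R) (F := F) (r - 1) t (s - 1) (by lia) ∘ₗ
    TensorProduct.map LinearMap.id (evalPow v s) +
  sgn R r • in1 (R := R) (F := F) (r - 1) (t - 1) s (by lia) ∘ₗ
    TensorProduct.map (evalPow u t) LinearMap.id +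
  in2 (R := R) (F := F) (r - 1) (t - 1) (s - 1) (by lia) ∘ₗ
    minorComul η X.flip t s +
  in3 (R := R) (F := F) (r - 1) (s - 1) (t - 1) (by lia) ∘ₗ
    minorComul η X s t ∘ₗ
    (TensorProduct.comm R (ExtPow R (Module.Dual R F) t) (ExtPow R (Module.Dual R F) s)).toLinearMap

/-- The map `fᵣ(2)⁽ᵗ⁾` on `⋀ᵗ F ⊗ ⋀ˢ F*`, `s + t = r`. -/
def f2 (r t s : ℤ) (h : s + t = r) :
    ExtPow R F t ⊗[R] ExtPow R (Module.Dual R F) s →ₗ[R] FF R F (r - 1) :=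
  sgn R r • in1 (R := R) (F := F) (r - 1) t s (by lia) ∘ₗ
    TensorProduct.map (mapPow X t) LinearMap.id +
  in2 (R := R) (F := F) (r - 1) t (s - 1) (by lia) ∘ₗ
    TensorProduct.map LinearMap.id (evalPow v s) +
  sgn R (r + 1) • in2 (R := R) (F := F) (r - 1) (t - 1) s (by lia) ∘ₗ
    TensorProduct.map (contractPow (X.flip u) t) LinearMap.id +
  in4 (R := R) (F := F) (r - 1) (t - 1) (s - 1) (by lia) ∘ₗ mapComul X t s

/-- The map `fᵣ(3)⁽ᵗ⁾` on `⋀ᵗ F ⊗ ⋀ˢ F*`, `s + t = r`. -/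
def f3 (r t s : ℤ) (h : s + t = r) :
    ExtPow R F t ⊗[R] ExtPow R (Module.Dual R F) s →ₗ[R] FF R F (r - 1) :=
  sgn R (r + 1) • in1 (R := R) (F := F) (r - 1) s t (by lia) ∘ₗ
    TensorProduct.map LinearMap.id (mapPow X.flip t) ∘ₗ
    (TensorProduct.comm R (ExtPow R F t) (ExtPow R (Module.Dual R F) s)).toLinearMap +
  sgn R (r + 1) • in3 (R := R) (F := F) (r - 1) t (s - 1) (by lia) ∘ₗ
    TensorProduct.map LinearMap.id (evalPow u s) +
  in3 (R := R) (F := F) (r - 1) (t - 1) s (by lia) ∘ₗ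
    TensorProduct.map (contractPow (X v) t) LinearMap.id +
  (-1 : R) • in4 (R := R) (F := F) (r - 1) (s - 1) (t - 1) (by lia) ∘ₗ
    (TensorProduct.comm R (ExtPow R (Module.Dual R F) (t - 1))
      (ExtPow R (Module.Dual R F) (s - 1))).toLinearMap ∘ₗ
    mapComul X.flip t s

/-- The map `fᵣ(4)⁽ᵗ⁾` on `⋀ᵗ F* ⊗ ⋀ˢ F*`, `s + t = r - 1`. -/
def f4 (r t s : ℤ) (h : s + t = r - 1) :
    ExtPow R (Module.Dual R F) t ⊗[R] ExtPow R (Module.Dual R F) s →ₗ[R] FF R F (r - 1) :=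
  sgn R r • in2 (R := R) (F := F) (r - 1) t s (by lia) ∘ₗ
    TensorProduct.map (minor η X.flip t) LinearMap.id +
  sgn R r • in3 (R := R) (F := F) (r - 1) s t (by lia) ∘ₗ
    TensorProduct.map (minor η X s) LinearMap.id ∘ₗ
    (TensorProduct.comm R (ExtPow R (Module.Dual R F) t) (ExtPow R (Module.Dual R F) s)).toLinearMap +
  in4 (R := R) (F := F) (r - 1) t (s - 1) (by lia) ∘ₗ
    TensorProduct.map LinearMap.id (evalPow v s) +
  sgn R r • in4 (R := R) (F := F) (r - 1) (t - 1) s (by lia) ∘ₗ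
    TensorProduct.map (evalPow u t) LinearMap.id

/-- The map `fᵣ(1) : 𝔽ᵣ(1) → 𝔽ᵣ₋₁` with components `fᵣ(1)⁽ᵗ⁾`. -/
def g1 (r : ℤ) : F1 R F r →ₗ[R] FF R F (r - 1) :=
  DirectSum.toModule R ℤ (FF R F (r - 1))
    (fun t => f1 u X v η r t (r + 1 - t) (sub_add_cancel _ _))

/-- The map `fᵣ(2) : 𝔽ᵣ(2) → 𝔽ᵣ₋₁` with components `fᵣ(2)⁽ᵗ⁾`. -/
def g2 (r : ℤ) : F2 R F r →ₗ[R] FF R F (r - 1) :=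
  DirectSum.toModule R ℤ (FF R F (r - 1))
    (fun t => f2 u X v r t (r - t) (sub_add_cancel _ _))

/-- The map `fᵣ(3) : 𝔽ᵣ(3) → 𝔽ᵣ₋₁` with components `fᵣ(3)⁽ᵗ⁾`. -/
def g3 (r : ℤ) : F3 R F r →ₗ[R] FF R F (r - 1) :=
  DirectSum.toModule R ℤ (FF R F (r - 1))
    (fun t => f3 u X v r t (r - t) (sub_add_cancel _ _))

/-- The map `fᵣ(4) : 𝔽ᵣ(4) → 𝔽ᵣ₋₁` with components `fᵣ(4)⁽ᵗ⁾`. -/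
def g4 (r : ℤ) : F4 R F r →ₗ[R] FF R F (r - 1) :=
  DirectSum.toModule R ℤ (FF R F (r - 1))
    (fun t => f4 u X v η r t (r - 1 - t) (sub_add_cancel _ _))

/-- The map `fᵣ : 𝔽ᵣ → 𝔽ᵣ₋₁`. -/
def f (r : ℤ) : FF R F r →ₗ[R] FF R F (r - 1) :=
  (g1 u X v η r).coprod ((g2 u X v r).coprod ((g3 u X v r).coprod (g4 u X v η r)))

end Complex

end MergedKoszul

end

/-! Fix a basis `e i` of `F` with dual basis `e' i`. The component of bidegree `(1, t-1)` of `Δ(x)`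
is `∑ e i ⊗ (e' i)(x)`, and dually for `F*`. So every term of `f` that uses co-multiplication
contains the single operator `K = ∑ (e' i) ⊗ (e i)` on `⋀F ⊗ ⋀F*`, composed with exterior powers of
`X` or `X*`, or with the minor maps `N_Y(α) = [(⋀Y)(α[η])](η)` for `Y = X, X*`.

Forgetting the grading embeds `𝔽ᵣ` in `A₁ × A₂ × A₂ × A₁` with `A₁ = ⋀F* ⊗ ⋀F*` and `A₂ = ⋀F ⊗ ⋀F*`.
There `f` becomes an operator `d s` that depends on `r` only through `s = (-1)ʳ`, and `d (-s) ∘ d s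
= 0` is a formal consequence of three kinds of relations (`MergedOps.d_neg_d`, `ops_relations`):

(a) Contractions square to zero, commute when they act on different tensor factors, anticommute with
`K`, and pass through `⋀X`, `⋀X*` and `N_Y`.

(b) `N_Y ∘ ⋀Y*` is multiplication by a scalar, and `K` is compatible with `N_Y ⊗ ⋀Y`, because `Y`
and `Y*` have transposed matrices.

(c) `x Kᵖ N₂ = y Kᵖ N₃` for `p = 0, 1, 2`, where `x`, `y` come from `⋀X`, `⋀X*` and `N₂`, `N₃` from
`N_{X*}`, `N_X`. This is the heart of the matter. It combines the cofactor identity `(⋀X)(γ(N_{X*}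
α)) = (N_X γ)(α)` with the transposition rule that `δ(N_X γ)` and `γ(N_{X*} δ)` have the same scalar
part, and sums over dual families of degree `p`.

The orientation elements enter through two facts: a top element is killed by every vector, whence
`(b(a))(η) = b ∧ a(η)` (`act_act_of_top`), and `η(ε) = 1`. -/

noncomputable section

namespace MergedKoszul

/-! ### Contractions, the action of one exterior algebra on another, and the scalar pairing -/

section Contraction

variable {R M N M' N' : Type*} [CommRing R] [AddCommGroup M] [Module R M] [AddCommGroup N]
  [Module R N] [AddCommGroup M'] [Module R M'] [AddCommGroup N'] [Module R N']

/-- Contraction of the exterior algebra by a functional. -/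
def contr (d : Module.Dual R N) : ExteriorAlgebra R N →ₗ[R] ExteriorAlgebra R N :=
  CliffordAlgebra.contractLeft (Q := (0 : QuadraticForm R N)) d

theorem contr_ι_mul (d : Module.Dual R N) (m : N) (x : ExteriorAlgebra R N) :
    contr d (ExteriorAlgebra.ι R m * x) = d m • x - ExteriorAlgebra.ι R m * contr d x :=
  CliffordAlgebra.contractLeft_ι_mul (Q := (0 : QuadraticForm R N)) (d := d) m x

theorem contr_algebraMap (d : Module.Dual R N) (r : R) :
    contr d (algebraMap R (ExteriorAlgebra R N) r) = 0 :=
  CliffordAlgebra.contractLeft_algebraMap (Q := (0 : QuadraticForm R N)) d r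

theorem contr_contr (d : Module.Dual R N) (x : ExteriorAlgebra R N) : contr d (contr d x) = 0 :=
  CliffordAlgebra.contractLeft_contractLeft (Q := (0 : QuadraticForm R N)) d x

theorem contr_comm (d d' : Module.Dual R N) (x : ExteriorAlgebra R N) :
    contr d (contr d' x) = -contr d' (contr d x) :=
  CliffordAlgebra.contractLeft_comm (Q := (0 : QuadraticForm R N)) d d' x

theorem contr_smul (r : R) (d : Module.Dual R N) (x : ExteriorAlgebra R N) :
    contr (r • d) x = r • contr d x := by
  simp [contr]

theorem contr_sum {ι : Type*} (s : Finset ι) (d : ι → Module.Dual R N) (x : ExteriorAlgebra R N) :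
    contr (∑ i ∈ s, d i) x = ∑ i ∈ s, contr (d i) x := by
  simp [contr]

theorem act_ι_apply (P : M →ₗ[R] Module.Dual R N) (m : M) (x : ExteriorAlgebra R N) :
    act P (ExteriorAlgebra.ι R m) x = contr (P m) x := act_ι P m x

theorem act_mul (P : M →ₗ[R] Module.Dual R N) (a b : ExteriorAlgebra R M)
    (x : ExteriorAlgebra R N) : act P (a * b) x = act P a (act P b x) := by
  rw [map_mul, Module.End.mul_apply]

theorem act_algebraMap (P : M →ₗ[R] Module.Dual R N) (r : R) (x : ExteriorAlgebra R N) :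
    act P (algebraMap R _ r) x = r • x := by
  rw [AlgHom.commutes, Module.algebraMap_end_apply]

/-- Induction on left multiplication by generators. -/
theorem ext_induction {p : ExteriorAlgebra R M → Prop} (h0 : ∀ r, p (algebraMap R _ r))
    (h1 : ∀ x y, p x → p y → p (x + y)) (h2 : ∀ x m, p x → p (ExteriorAlgebra.ι R m * x)) (x) :
    p x :=
  CliffordAlgebra.left_induction (Q := (0 : QuadraticForm R M)) h0 h1 h2 x

variable (R M) in
/-- The grading involution of the exterior algebra. -/
def invol : ExteriorAlgebra R M →ₐ[R] ExteriorAlgebra R M :=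
  CliffordAlgebra.involute (Q := (0 : QuadraticForm R M))

theorem invol_ι (m : M) : invol R M (ExteriorAlgebra.ι R m) = -ExteriorAlgebra.ι R m :=
  CliffordAlgebra.involute_ι (Q := (0 : QuadraticForm R M)) m

theorem invol_ι_mul (m : M) (x : ExteriorAlgebra R M) :
    invol R M (ExteriorAlgebra.ι R m * x) = -(ExteriorAlgebra.ι R m * invol R M x) := by
  rw [map_mul, invol_ι, neg_mul]

theorem invol_invol (x : ExteriorAlgebra R M) : invol R M (invol R M x) = x :=
  CliffordAlgebra.involute_involute (Q := (0 : QuadraticForm R M)) x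

theorem ι_mul_eq (m : M) (x : ExteriorAlgebra R M) :
    ExteriorAlgebra.ι R m * x = invol R M x * ExteriorAlgebra.ι R m := by
  induction x using ext_induction with
  | h0 r => rw [AlgHom.commutes, Algebra.commutes]
  | h1 x y hx hy => rw [map_add, mul_add, add_mul, hx, hy]
  | h2 x k hx =>
    have := ExteriorAlgebra.ι_add_mul_swap (R := R) m k
    rw [map_mul, invol_ι, neg_mul, neg_mul, mul_assoc, ← hx, ← mul_assoc, ← mul_assoc,
      eq_neg_iff_add_eq_zero, ← add_mul, this, zero_mul]

theorem invol_contr (d : Module.Dual R N) (x : ExteriorAlgebra R N) :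
    invol R N (contr d x) = -contr d (invol R N x) := by
  induction x using ext_induction with
  | h0 r => simp [contr_algebraMap]
  | h1 x y hx hy => simp only [map_add, hx, hy, neg_add]
  | h2 x k hx =>
    rw [contr_ι_mul, map_sub, map_smul, map_mul, map_mul, invol_ι, hx, neg_mul, neg_mul, map_neg,
      contr_ι_mul]
    simp

theorem invol_act (P : M →ₗ[R] Module.Dual R N) (a : ExteriorAlgebra R M)
    (x : ExteriorAlgebra R N) : invol R N (act P a x) = act P (invol R M a) (invol R N x) := by
  induction a using ext_induction generalizing x with
  | h0 r => simp only [AlgHom.commutes, Module.algebraMap_end_apply, map_smul]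
  | h1 a b ha hb => simp only [map_add, LinearMap.add_apply, ha, hb]
  | h2 a k ha =>
    rw [act_mul, act_ι_apply, invol_contr, ha, map_mul, invol_ι, act_mul, map_neg,
      LinearMap.neg_apply, act_ι_apply]

/-- The graded commutator of the operator `a` with multiplication by `y` is the action of `y(a)`;
for `a` of degree one this is the Leibniz rule, and induction on `a` does the rest. Both
`act_act_of_top` and `scal_act` come from it. -/
theorem act_contr (P : M →ₗ[R] Module.Dual R N) (y : N) (a : ExteriorAlgebra R M)
    (x : ExteriorAlgebra R N) :
    act P (contr (P.flip y) a) x =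
      ExteriorAlgebra.ι R y * act P a x - act P (invol R M a) (ExteriorAlgebra.ι R y * x) := by
  induction a using ext_induction with
  | h0 r => simp [contr_algebraMap, AlgHom.commutes, Module.algebraMap_end_apply]
  | h1 a b ha hb =>
    simp only [map_add, LinearMap.add_apply, ha, hb, mul_add]
    abel
  | h2 a k ha =>
    rw [contr_ι_mul, map_sub, LinearMap.sub_apply, map_smul, LinearMap.smul_apply, act_mul, ha,
      invol_ι_mul, act_mul, map_neg, LinearMap.neg_apply, act_ι_apply, act_mul, act_ι_apply,
      map_sub, contr_ι_mul, LinearMap.flip_apply, act_ι_apply]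
    abel

/-- Contracting first and then acting on a top element is multiplication after acting. -/
theorem act_act_of_top (P : M →ₗ[R] Module.Dual R N) {Q : N →ₗ[R] Module.Dual R M}
    (hQ : Q = P.flip) {η : ExteriorAlgebra R N}
    (hη : ∀ y, ExteriorAlgebra.ι R y * η = 0) (b : ExteriorAlgebra R N)
    (a : ExteriorAlgebra R M) : act P (act Q b a) η = b * act P a η := by
  subst hQ
  induction b using ext_induction with
  | h0 r => rw [act_algebraMap, map_smul, LinearMap.smul_apply, Algebra.smul_def]
  | h1 b c hb hc => rw [map_add, LinearMap.add_apply, map_add, LinearMap.add_apply, hb, hc, add_mul]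
  -- The second term of the commutator contains `k ∧ η`, which vanishes.
  | h2 b k hb => rw [act_mul, act_ι_apply, act_contr, hη, map_zero, sub_zero, hb, mul_assoc]

theorem map_contr (Y : N →ₗ[R] N') (d : Module.Dual R N') (x : ExteriorAlgebra R N) :
    ExteriorAlgebra.map Y (contr (d ∘ₗ Y) x) = contr d (ExteriorAlgebra.map Y x) := by
  induction x using ext_induction with
  | h0 r => simp [contr_algebraMap, AlgHom.commutes]
  | h1 x y hx hy => simp only [map_add, hx, hy]
  | h2 x k hx =>
    rw [contr_ι_mul, map_sub, map_smul, map_mul, map_mul, hx, ExteriorAlgebra.map_apply_ι,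
      contr_ι_mul, LinearMap.comp_apply]

/-- The projection formula: `h` says that `Z` and `Y` are adjoint, and the adjunction extends from
generators to products. -/
theorem map_act (P : M →ₗ[R] Module.Dual R N) (P' : M' →ₗ[R] Module.Dual R N')
    (Z : M' →ₗ[R] M) (Y : N →ₗ[R] N') (h : ∀ m, P (Z m) = P' m ∘ₗ Y)
    (a : ExteriorAlgebra R M') (x : ExteriorAlgebra R N) :
    ExteriorAlgebra.map Y (act P (ExteriorAlgebra.map Z a) x) =
      act P' a (ExteriorAlgebra.map Y x) := by
  induction a using ext_induction generalizing x with
  | h0 r => simp only [AlgHom.commutes, Module.algebraMap_end_apply, map_smul]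
  | h1 a b ha hb => simp only [map_add, LinearMap.add_apply, ha, hb]
  | h2 a k ha =>
    rw [map_mul, act_mul, act_mul, ExteriorAlgebra.map_apply_ι, act_ι_apply, act_ι_apply, h,
      map_contr, ha]

/-- The component of degree zero. -/
abbrev scal : ExteriorAlgebra R M →ₐ[R] R := ExteriorAlgebra.algebraMapInv

theorem scal_algebraMap (r : R) : scal (algebraMap R (ExteriorAlgebra R M) r) = r :=
  ExteriorAlgebra.algebraMap_leftInverse M r

theorem scal_ι (m : M) : scal (ExteriorAlgebra.ι R m) = 0 := by
  simp [ExteriorAlgebra.algebraMapInv]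

theorem scal_ι_mul (m : M) (x : ExteriorAlgebra R M) : scal (ExteriorAlgebra.ι R m * x) = 0 := by
  rw [map_mul, scal_ι, zero_mul]

theorem scal_map (Y : M →ₗ[R] N) (x : ExteriorAlgebra R M) :
    scal (ExteriorAlgebra.map Y x) = scal x := by
  induction x using ext_induction with
  | h0 r => rw [AlgHom.commutes, scal_algebraMap, scal_algebraMap]
  | h1 x y hx hy => simp only [map_add, hx, hy]
  | h2 x k hx => rw [map_mul, map_mul, map_mul, ExteriorAlgebra.map_apply_ι, scal_ι, scal_ι,
      zero_mul, zero_mul]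

theorem scal_invol (x : ExteriorAlgebra R M) : scal (invol R M x) = scal x := by
  induction x using ext_induction with
  | h0 r => rw [AlgHom.commutes]
  | h1 x y hx hy => simp only [map_add, hx, hy]
  | h2 x k hx => simp only [map_mul, invol_ι, map_neg, scal_ι, neg_zero, zero_mul]

theorem act_algebraMap_right (P : M →ₗ[R] Module.Dual R N) (a : ExteriorAlgebra R M) (r : R) :
    act P a (algebraMap R _ r) = algebraMap R _ (scal a * r) := by
  induction a using ext_induction with
  | h0 s => rw [act_algebraMap, scal_algebraMap, map_mul, Algebra.smul_def]
  | h1 a b ha hb => simp only [map_add, LinearMap.add_apply, ha, hb, add_mul]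
  | h2 a k ha => rw [act_mul, ha, act_ι_apply, contr_algebraMap, scal_ι_mul, zero_mul, map_zero]

/-- The scalar parts of `α(a)` and `a(α)` agree. -/
theorem scal_act (P : M →ₗ[R] Module.Dual R N) {Q : N →ₗ[R] Module.Dual R M}
    (hQ : Q = P.flip) (a : ExteriorAlgebra R M)
    (x : ExteriorAlgebra R N) : scal (act P a x) = scal (act Q x a) := by
  subst hQ
  induction a using ext_induction generalizing x with
  | h0 r => rw [act_algebraMap, act_algebraMap_right, map_smul, scal_algebraMap, smul_eq_mul,
      mul_comm]
  | h1 a b ha hb => simp only [map_add, LinearMap.add_apply, ha, hb]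
  | h2 a k ha =>
    -- The commutator formula with the two algebras exchanged. Its term `k ∧ _` has no scalar part;
    -- taking the involution of `x` absorbs the sign of moving `k` past `x`.
    have h := act_contr P.flip k (invol R N x) a
    rw [invol_invol, LinearMap.flip_flip, eq_sub_iff_add_eq, ← eq_sub_iff_add_eq'] at h
    rw [h, map_sub, scal_ι_mul, zero_sub, ← ha, ι_mul_eq, act_mul, act_ι_apply,
      ← scal_invol, invol_act, invol_invol, invol_contr, map_neg, map_neg]

end Contraction

/-! ### Signs, homogeneous elements and vanishing above the top degree -/

section Homogeneous

variable {R M N : Type*} [CommRing R] [AddCommGroup M] [Module R M] [AddCommGroup N] [Module R N]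

theorem sgn_add_one (r : ℤ) : sgn R (r + 1) = -sgn R r := by
  simp [sgn, Int.negOnePow_succ]

theorem sgn_sub_one (r : ℤ) : sgn R (r - 1) = -sgn R r := by
  rw [← neg_eq_iff_eq_neg, ← sgn_add_one, sub_add_cancel]

theorem sgn_add (r s : ℤ) : sgn R (r + s) = sgn R r * sgn R s := by
  simp [sgn, Int.negOnePow_add]

theorem sgn_zero : sgn R 0 = 1 := by
  simp [sgn]

theorem sgn_eq_one_or (r : ℤ) : sgn R r = 1 ∨ sgn R r = -1 := by
  unfold sgn
  rcases Int.units_eq_one_or r.negOnePow with h | h <;> simp [h]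

theorem sgn_mul_self (r : ℤ) : sgn R r * sgn R r = 1 := by
  rcases sgn_eq_one_or (R := R) r with h | h <;> simp [h]

theorem ι_mem_Pow (m : M) : ExteriorAlgebra.ι R m ∈ ExtPow R M 1 := by
  change _ ∈ ⋀[R]^1 M
  rw [ExteriorAlgebra.exteriorPower, pow_one]
  exact ⟨m, rfl⟩

theorem algebraMap_mem_Pow (r : R) : algebraMap R (ExteriorAlgebra R M) r ∈ ExtPow R M 0 := by
  change _ ∈ ⋀[R]^0 M
  rw [ExteriorAlgebra.exteriorPower, pow_zero]
  exact Submodule.algebraMap_mem r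

theorem exists_of_mem_Pow_zero {x : ExteriorAlgebra R M} (hx : x ∈ ExtPow R M 0) :
    ∃ r, x = algebraMap R _ r := by
  change _ ∈ ⋀[R]^0 M at hx
  rw [ExteriorAlgebra.exteriorPower, pow_zero] at hx
  obtain ⟨r, hr⟩ := Submodule.mem_one.1 hx
  exact ⟨r, hr.symm⟩

theorem exists_of_mem_Pow_one {x : ExteriorAlgebra R M} (hx : x ∈ ExtPow R M 1) :
    ∃ m, x = ExteriorAlgebra.ι R m := by
  change _ ∈ ⋀[R]^1 M at hx
  rw [ExteriorAlgebra.exteriorPower, pow_one] at hx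
  obtain ⟨m, hm⟩ := hx
  exact ⟨m, hm.symm⟩

theorem eq_zero_of_mem_Pow_neg {k : ℤ} (hk : k < 0) {x : ExteriorAlgebra R M}
    (hx : x ∈ ExtPow R M k) : x = 0 := by
  rcases k with k | k
  · exact absurd hk (by simp)
  · exact hx

/-- Induction on homogeneous elements. -/
theorem Pow_induction {p : ℤ → ExteriorAlgebra R M → Prop} (h0 : ∀ k, p k 0)
    (h1 : ∀ r, p 0 (algebraMap R _ r)) (h2 : ∀ k x y, p k x → p k y → p k (x + y))
    (h3 : ∀ k m x, x ∈ ExtPow R M k → p k x → p (k + 1) (ExteriorAlgebra.ι R m * x))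
    {k : ℤ} {x : ExteriorAlgebra R M} (hx : x ∈ ExtPow R M k) : p k x := by
  rcases k with k | k
  · change x ∈ ⋀[R]^k M at hx
    induction hx using Submodule.pow_induction_on_left' with
    | algebraMap r => exact h1 r
    | add x y i hx hy ihx ihy => exact h2 _ _ _ ihx ihy
    | mem_mul m hm i x hx ih =>
      obtain ⟨m, rfl⟩ := hm
      exact h3 _ _ _ hx ih
  · rw [show x = 0 from hx]
    exact h0 _

theorem invol_of_mem {k : ℤ} {x : ExteriorAlgebra R M} (hx : x ∈ ExtPow R M k) :
    invol R M x = sgn R k • x := by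
  refine Pow_induction (p := fun k x => invol R M x = sgn R k • x) ?_ ?_ ?_ ?_ hx
  · intro k; simp
  · intro r; rw [AlgHom.commutes, sgn_zero, one_smul]
  · intro k x y hx hy; rw [map_add, hx, hy, smul_add]
  · intro k m x _ hx; rw [invol_ι_mul, hx, sgn_add_one, neg_smul, mul_smul_comm]

/-- Graded commutativity of the exterior algebra. -/
theorem mul_comm_of_mem {i j : ℤ} {x y : ExteriorAlgebra R M} (hx : x ∈ ExtPow R M i)
    (hy : y ∈ ExtPow R M j) : x * y = sgn R (i * j) • (y * x) := by
  refine Pow_induction (p := fun j y => x * y = sgn R (i * j) • (y * x)) ?_ ?_ ?_ ?_ hy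
  · intro k; simp
  · intro r; rw [mul_zero, sgn_zero, one_smul, Algebra.commutes]
  · intro k y z hy hz; rw [mul_add, add_mul, hy, hz, smul_add]
  · intro k m y _ hy
    have h : x * ExteriorAlgebra.ι R m = sgn R i • (ExteriorAlgebra.ι R m * x) := by
      rw [ι_mul_eq, invol_of_mem hx, smul_mul_assoc, smul_smul, sgn_mul_self, one_smul]
    rw [← mul_assoc, h, smul_mul_assoc, mul_assoc, hy, mul_add, mul_one, sgn_add, mul_smul_comm,
      smul_smul, mul_comm (sgn R i), mul_assoc]

theorem contr_mem {d : Module.Dual R N} {j : ℤ} {x : ExteriorAlgebra R N}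
    (hx : x ∈ ExtPow R N j) : contr d x ∈ ExtPow R N (j - 1) :=
  contract_mem_Pow d rfl hx

theorem homogeneous_induction {p : ExteriorAlgebra R M → Prop}
    (h : ∀ k, ∀ x ∈ ExtPow R M k, p x) (hadd : ∀ x y, p x → p y → p (x + y)) (x) : p x := by
  induction x using DirectSum.Decomposition.inductionOn (fun i : ℕ => ⋀[R]^i M) with
  | zero => exact h 0 0 (zero_mem _)
  | homogeneous m => exact h _ _ (mem_ExtPow_natCast.2 m.2)
  | add x y hx hy => exact hadd x y hx hy

theorem eq_zero_of_mem_Pow_gt {n : ℕ} (b : Module.Basis (Fin n) R M) {k : ℤ} (hk : n < k)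
    {x : ExteriorAlgebra R M} (hx : x ∈ ExtPow R M k) : x = 0 := by
  obtain ⟨k, rfl⟩ := Int.eq_ofNat_of_zero_le (show 0 ≤ k by lia)
  have : IsEmpty (Set.powersetCard (Fin n) k) := by
    refine ⟨fun s => ?_⟩
    have h1 := s.2
    rw [Set.powersetCard.mem_iff] at h1
    have h2 := Finset.card_le_univ s.1
    rw [Fintype.card_fin] at h2
    lia
  have : Subsingleton (⋀[R]^k M) := (b.exteriorPower k).repr.toEquiv.subsingleton
  exact congrArg Subtype.val (Subsingleton.elim (⟨x, hx⟩ : ⋀[R]^k M) 0)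

theorem ι_mul_top {n : ℕ} (b : Module.Basis (Fin n) R M) {x : ExteriorAlgebra R M}
    (hx : x ∈ ⋀[R]^n M) (m : M) : ExteriorAlgebra.ι R m * x = 0 :=
  eq_zero_of_mem_Pow_gt b (k := 1 + n) (by lia)
    (mul_mem_Pow rfl (ι_mem_Pow m) (mem_ExtPow_natCast.2 hx))

end Homogeneous

/-! ### The minor maps: cofactor identity and transposition -/

section Minors

variable {R F D : Type*} [CommRing R] [AddCommGroup F] [Module R F] [AddCommGroup D] [Module R D]
  (P : D →ₗ[R] Module.Dual R F) (Q : F →ₗ[R] Module.Dual R D)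

/-- `⋀ D → ⋀ F`, `α ↦ [(⋀ Y)(α[η])](η)`. -/
def minorMap (η : ExteriorAlgebra R F) (Y : F →ₗ[R] D) :
    ExteriorAlgebra R D →ₗ[R] ExteriorAlgebra R F :=
  (act P).toLinearMap.flip η ∘ₗ (ExteriorAlgebra.map Y).toLinearMap ∘ₗ
    (act P).toLinearMap.flip η

theorem minorMap_apply (η : ExteriorAlgebra R F) (Y : F →ₗ[R] D) (α : ExteriorAlgebra R D) :
    minorMap P η Y α = act P (ExteriorAlgebra.map Y (act P α η)) η := rfl

variable {P Q}

theorem minorMap_mem {n : ℕ} {η : ExteriorAlgebra R F} (hη : η ∈ ⋀[R]^n F) (Y : F →ₗ[R] D) {k : ℤ}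
    {α : ExteriorAlgebra R D} (hα : α ∈ ExtPow R D k) : minorMap P η Y α ∈ ExtPow R F k :=
  act_mem_Pow P (i := n - k) (j := n) (by ring)
    (map_mem_Pow Y (act_mem_Pow P rfl hα (mem_ExtPow_natCast.2 hη)))
    (mem_ExtPow_natCast.2 hη)

/-- `[(⋀ Y)(α[η])](η)` is compatible with contraction. -/
theorem minorMap_act (hQ : Q = P.flip) {η : ExteriorAlgebra R F}
    (hη : ∀ y, ExteriorAlgebra.ι R y * η = 0) (Y : F →ₗ[R] D) (a : ExteriorAlgebra R F)
    (α : ExteriorAlgebra R D) :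
    minorMap P η Y (act Q a α) = act P (ExteriorAlgebra.map Y a) (minorMap P η Y α) := by
  -- `(a(α))(η) = a ∧ α(η)`, and `⋀Y` is multiplicative.
  rw [minorMap_apply, act_act_of_top P hQ hη, map_mul, act_mul, minorMap_apply]

/-- Composing with the exterior powers of the transposed map gives a scalar. -/
theorem exists_minorMap_map (hQ : Q = P.flip) {n : ℕ} {η : ExteriorAlgebra R F}
    (hηn : η ∈ ⋀[R]^n F) (hη : ∀ y, ExteriorAlgebra.ι R y * η = 0) {Y Z : F →ₗ[R] D}
    (h : ∀ m, P (Z m) = Q m ∘ₗ Y) :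
    ∃ r : R, ∀ a, minorMap P η Y (ExteriorAlgebra.map Z a) = r • a := by
  -- The scalar is `((⋀Y)η)(η)`, which has degree `n - n = 0`.
  obtain ⟨r, hr⟩ := exists_of_mem_Pow_zero
    (act_mem_Pow P (i := n) (j := n) (k := 0) (by ring)
      (map_mem_Pow Y (mem_ExtPow_natCast.2 hηn)) (mem_ExtPow_natCast.2 hηn))
  refine ⟨r, fun a => ?_⟩
  rw [minorMap_apply, map_act P Q Z Y h, act_act_of_top P hQ hη, hr, Algebra.smul_def,
    Algebra.commutes]

/-- The cofactor identity. -/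
theorem map_act_minorMap (hQ : Q = P.flip) {n : ℕ} {η : ExteriorAlgebra R F}
    (hηn : η ∈ ⋀[R]^n F) {ε : ExteriorAlgebra R D}
    (hε : ∀ y, ExteriorAlgebra.ι R y * ε = 0) (hηε : act Q η ε = 1) {X Z : F →ₗ[R] D}
    (h : ∀ m, P (Z m) = Q m ∘ₗ X) {p t : ℤ} {γ α : ExteriorAlgebra R D}
    (hγ : γ ∈ ExtPow R D p) (hα : α ∈ ExtPow R D t) :
    ExteriorAlgebra.map X (act P γ (minorMap P η Z α)) = act Q (minorMap P η X γ) α := by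
  have hP : P = Q.flip := by rw [hQ, LinearMap.flip_flip]
  set a := act P α η with ha
  have ham : a ∈ ExtPow R F (n - t) := act_mem_Pow P rfl hα (mem_ExtPow_natCast.2 hηn)
  set g := minorMap P η X γ with hg
  have hgm : g ∈ ExtPow R F p := minorMap_mem hηn X hγ
  -- By definition `g = b(η)` with `b = (⋀X)(γ(η))`, so `g(ε) = b ∧ η(ε) = b`. Here `F` and `D`
  -- exchange roles and `ε` is the top element.
  have hgε : act Q g ε = ExteriorAlgebra.map X (act P γ η) := by
    rw [hg, minorMap_apply, act_act_of_top Q hP hε, hηε, mul_one]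
  -- Swap `γ` with `(⋀Z)a`, carry `⋀X` across by adjunction to get `a(g(ε))`, then swap `a` with
  -- `g`. Both swaps involve the degrees `p` and `n - t`, so the signs cancel. What is left is
  -- `g(a(ε))`, and `a(ε) = α ∧ η(ε) = α`.
  rw [minorMap_apply, ← ha, ← act_mul, mul_comm_of_mem hγ (map_mem_Pow Z ham), map_smul,
    LinearMap.smul_apply, map_smul, act_mul, map_act P Q Z X h, ← hgε, ← act_mul,
    mul_comm_of_mem ham hgm, map_smul, LinearMap.smul_apply, smul_smul, mul_comm p, sgn_mul_self,
    one_smul, act_mul, ha, act_act_of_top Q hP hε, hηε, mul_one]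

/-- Transposing `Y` transposes the map `[(⋀ Y)(·[η])](η)`. -/
theorem scal_act_minorMap (hQ : Q = P.flip) {n : ℕ} {η : ExteriorAlgebra R F}
    (hηn : η ∈ ⋀[R]^n F) {X Z : F →ₗ[R] D}
    (h : ∀ m, P (X m) = Q m ∘ₗ Z) {p : ℤ} {γ δ : ExteriorAlgebra R D}
    (hγ : γ ∈ ExtPow R D p) (hδ : δ ∈ ExtPow R D p) :
    scal (act P δ (minorMap P η X γ)) = scal (act P γ (minorMap P η Z δ)) := by
  -- Moving `β` next to `η` costs a sign that depends only on `p` and `n`, hence is the same on both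
  -- sides of the claim. It remains to move `⋀X` across the scalar pairing of `γ(η)` with `δ(η)`,
  -- where it becomes `⋀Z`.
  have key : ∀ {α β : ExteriorAlgebra R D} (Y : F →ₗ[R] D)
      (_ : α ∈ ExtPow R D p) (_ : β ∈ ExtPow R D p),
      scal (act P β (minorMap P η Y α)) = sgn R (p * (n - p)) *
        scal (act P (ExteriorAlgebra.map Y (act P α η)) (act P β η)) := by
    intro α β Y hα hβ
    rw [minorMap_apply, ← act_mul, mul_comm_of_mem hβ (map_mem_Pow Y
      (act_mem_Pow P rfl hα (mem_ExtPow_natCast.2 hηn))), map_smul,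
      LinearMap.smul_apply, map_smul, act_mul, smul_eq_mul]
  rw [key X hγ hδ, key Z hδ hγ, scal_act P hQ _ (act P γ η), ← map_act P Q X Z h, scal_map]

end Minors

theorem sum_sum_eq_sum_lt {ι A : Type*} [Fintype ι] [LinearOrder ι] [AddCommMonoid A]
    (g : ι → ι → A) (h : ∀ i, g i i = 0) :
    ∑ i, ∑ j, g i j = ∑ p : ι × ι with p.1 < p.2, (g p.1 p.2 + g p.2 p.1) := by
  have h1 : ∀ p : ι × ι, g p.1 p.2 =
      (if p.1 < p.2 then g p.1 p.2 else 0) + if p.2 < p.1 then g p.1 p.2 else 0 := by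
    rintro ⟨i, j⟩
    rcases lt_trichotomy i j with hij | rfl | hij
    · simp [hij, hij.asymm]
    · simp [h]
    · simp [hij, hij.asymm]
  rw [← Fintype.sum_prod_type', Finset.sum_congr rfl fun p _ => h1 p, Finset.sum_add_distrib,
    Finset.sum_add_distrib, Finset.sum_filter, Finset.sum_filter,
    ← (Equiv.prodComm ι ι).sum_comp fun p => if p.2 < p.1 then g p.1 p.2 else 0]
  rfl

/-! ### Dual families and the operator `K` -/

section Duality

variable {R F D : Type*} [CommRing R] [AddCommGroup F] [Module R F] [AddCommGroup D] [Module R D]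
  {P : D →ₗ[R] Module.Dual R F} {Q : F →ₗ[R] Module.Dual R D} {n : ℕ}

section Families

variable {κ : Type*} {s : Finset κ} {p : ℤ} {γ : κ → ExteriorAlgebra R D}
  {g : κ → ExteriorAlgebra R F}

/-- Expanded in the `g k`, the two sides have as coefficients the matrices of the minor maps of `X`
and `Z`, which are transposes of each other by `scal_act_minorMap`. Hypothesis `hg` says that `γ`
and `g` are dual families up to the constant `c`, which is needed because the pairing in degree two
is the negative of the determinant. -/
theorem sum_minorMap_tmul (hQ : Q = P.flip) {η : ExteriorAlgebra R F}
    (hηn : η ∈ ⋀[R]^n F) {X Z : F →ₗ[R] D} (h : ∀ m, P (X m) = Q m ∘ₗ Z) {c : R}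
    (hγ : ∀ k ∈ s, γ k ∈ ExtPow R D p)
    (hg : ∀ x ∈ ExtPow R F p, x = ∑ k ∈ s, (c * scal (act P (γ k) x)) • g k) :
    ∑ k ∈ s, minorMap P η X (γ k) ⊗ₜ[R] g k = ∑ k ∈ s, g k ⊗ₜ[R] minorMap P η Z (γ k) := by
  have h1 : ∀ k ∈ s, minorMap P η X (γ k) ⊗ₜ[R] g k =
      ∑ l ∈ s, (c * scal (act P (γ l) (minorMap P η X (γ k)))) • (g l ⊗ₜ[R] g k) := by
    intro k hk
    conv_lhs => rw [hg _ (minorMap_mem hηn X (hγ k hk)), TensorProduct.sum_tmul]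
    simp only [TensorProduct.smul_tmul']
  have h2 : ∀ k ∈ s, g k ⊗ₜ[R] minorMap P η Z (γ k) =
      ∑ l ∈ s, (c * scal (act P (γ l) (minorMap P η Z (γ k)))) • (g k ⊗ₜ[R] g l) := by
    intro k hk
    conv_lhs => rw [hg _ (minorMap_mem hηn Z (hγ k hk)), TensorProduct.tmul_sum]
    simp only [TensorProduct.tmul_smul]
  rw [Finset.sum_congr rfl h1, Finset.sum_congr rfl h2, Finset.sum_comm]
  refine Finset.sum_congr rfl fun l hl => Finset.sum_congr rfl fun k hk => ?_
  rw [scal_act_minorMap hQ hηn h (hγ k hk) (hγ l hl)]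

/-- The source of the relations `x Kᵖ N₂ = y Kᵖ N₃`: let the two sides of `sum_minorMap_tmul` act on
`α ⊗ β`, and rewrite `(N_X γ)(α)` and `(N_Z γ)(β)` by the cofactor identity. -/
theorem sum_map_act_minorMap_tmul (hQ : Q = P.flip) {η : ExteriorAlgebra R F}
    (hηn : η ∈ ⋀[R]^n F) {ε : ExteriorAlgebra R D} (hε : ∀ y, ExteriorAlgebra.ι R y * ε = 0)
    (hηε : act Q η ε = 1) {X Z : F →ₗ[R] D} (h : ∀ m, P (X m) = Q m ∘ₗ Z)
    (h' : ∀ m, P (Z m) = Q m ∘ₗ X) {c : R} (hγ : ∀ k ∈ s, γ k ∈ ExtPow R D p)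
    (hg : ∀ x ∈ ExtPow R F p, x = ∑ k ∈ s, (c * scal (act P (γ k) x)) • g k)
    (α β : ExteriorAlgebra R D) :
    ∑ k ∈ s, ExteriorAlgebra.map X (act P (γ k) (minorMap P η Z α)) ⊗ₜ[R] act Q (g k) β =
      ∑ k ∈ s, act Q (g k) α ⊗ₜ[R] ExteriorAlgebra.map Z (act P (γ k) (minorMap P η X β)) := by
  induction α using homogeneous_induction with
  | hadd α α' hα hα' => simp only [map_add, TensorProduct.add_tmul, Finset.sum_add_distrib, hα, hα']
  | h i α hα =>
    induction β using homogeneous_induction with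
    | hadd β β' hβ hβ' =>
      simp only [map_add, TensorProduct.tmul_add, Finset.sum_add_distrib, hβ, hβ']
    | h j β hβ =>
      have := congrArg (TensorProduct.map ((act Q).toLinearMap.flip α)
        ((act Q).toLinearMap.flip β)) (sum_minorMap_tmul hQ hηn h hγ hg)
      simp only [map_sum, TensorProduct.map_tmul, LinearMap.flip_apply,
        AlgHom.toLinearMap_apply] at this
      rw [Finset.sum_congr rfl fun k hk => by
        rw [map_act_minorMap hQ hηn hε hηε h' (hγ k hk) hα], this]
      refine Finset.sum_congr rfl fun k hk => ?_
      rw [map_act_minorMap hQ hηn hε hηε h (hγ k hk) hβ]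

end Families

variable {e : Fin n → F} {e' : Fin n → D}

/-- The dual family of degree zero, written as a sum over one index to fit the shape of `hg`. -/
theorem eq_scal_of_mem_zero {x : ExteriorAlgebra R F} (hx : x ∈ ExtPow R F 0) :
    x = ∑ _k ∈ ({()} : Finset Unit), (1 * scal (act P 1 x)) • (1 : ExteriorAlgebra R F) := by
  obtain ⟨r, rfl⟩ := exists_of_mem_Pow_zero hx
  rw [Finset.sum_singleton, map_one, Module.End.one_apply, scal_algebraMap, one_mul,
    Algebra.algebraMap_eq_smul_one]

theorem eq_sum_of_mem_one (he : ∀ x, ∑ i, P (e' i) x • e i = x) {x : ExteriorAlgebra R F}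
    (hx : x ∈ ExtPow R F 1) :
    x = ∑ i, (1 * scal (act P (ExteriorAlgebra.ι R (e' i)) x)) • ExteriorAlgebra.ι R (e i) := by
  obtain ⟨m, rfl⟩ := exists_of_mem_Pow_one hx
  conv_lhs => rw [← he m, map_sum]
  refine Finset.sum_congr rfl fun i _ => ?_
  have := contr_ι_mul (P (e' i)) m 1
  rw [← map_one (algebraMap R (ExteriorAlgebra R F)), contr_algebraMap, mul_zero, sub_zero,
    map_one, mul_one] at this
  rw [act_ι_apply, this, map_smul, map_smul, map_one, smul_eq_mul, mul_one, one_mul]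

theorem scal_contr_contr_ι_mul_ι (d d' : Module.Dual R F) (m m' : F) :
    scal (contr d' (contr d (ExteriorAlgebra.ι R m * ExteriorAlgebra.ι R m'))) =
      d m * d' m' - d' m * d m' := by
  have h : ∀ (d : Module.Dual R F) m, contr d (ExteriorAlgebra.ι R m) = algebraMap R _ (d m) := by
    intro d m
    have := contr_ι_mul d m 1
    rwa [← map_one (algebraMap R (ExteriorAlgebra R F)), contr_algebraMap, mul_zero, sub_zero,
      map_one, mul_one, ← Algebra.algebraMap_eq_smul_one] at this
  rw [contr_ι_mul, h, map_sub, map_smul, h, contr_ι_mul, contr_algebraMap, mul_zero, sub_zero,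
    map_sub, map_smul, map_smul, scal_algebraMap, scal_algebraMap, smul_eq_mul, smul_eq_mul]

/-- The constant is `-1` because `(α ∧ β)(m ∧ m') = α(β(m ∧ m'))` contracts with `β` first, and so
is minus the determinant of the pairing. -/
theorem eq_sum_of_mem_two (he : ∀ x, ∑ i, P (e' i) x • e i = x) {x : ExteriorAlgebra R F}
    (hx : x ∈ ExtPow R F 2) :
    x = ∑ k : Fin n × Fin n with k.1 < k.2,
      (-1 * scal (act P (ExteriorAlgebra.ι R (e' k.1) * ExteriorAlgebra.ι R (e' k.2)) x)) •
        (ExteriorAlgebra.ι R (e k.1) * ExteriorAlgebra.ι R (e k.2)) := by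
  change x ∈ ⋀[R]^2 F at hx
  rw [ExteriorAlgebra.exteriorPower, pow_two] at hx
  induction hx using Submodule.mul_induction_on' with
  | add x hx y hy hx' hy' =>
    simp only [map_add, mul_add, add_smul, Finset.sum_add_distrib]
    rw [← hx', ← hy']
  | mem_mul_mem x hx y hy =>
    obtain ⟨m, rfl⟩ := hx
    obtain ⟨m', rfl⟩ := hy
    have h1 : ExteriorAlgebra.ι R m * ExteriorAlgebra.ι R m' = ∑ i, ∑ j, (P (e' i) m * P (e' j) m') •
        (ExteriorAlgebra.ι R (e i) * ExteriorAlgebra.ι R (e j)) := by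
      conv_lhs => rw [← he m, ← he m', map_sum, map_sum, Finset.sum_mul_sum]
      simp only [map_smul, smul_mul_smul_comm]
    conv_lhs => rw [h1]
    rw [sum_sum_eq_sum_lt _ fun i => by rw [ExteriorAlgebra.ι_sq_zero, smul_zero]]
    refine Finset.sum_congr rfl fun k _ => ?_
    rw [act_mul, act_ι_apply, act_ι_apply, scal_contr_contr_ι_mul_ι,
      eq_neg_of_add_eq_zero_left (ExteriorAlgebra.ι_add_mul_swap (R := R) (e k.2) (e k.1)),
      smul_neg, ← sub_eq_add_neg, ← sub_smul]
    congr 1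
    ring

/-- The operator `a ⊗ β ↦ ∑ᵢ eᵢ'(a) ⊗ eᵢ(β)`. -/
def koszul (P : D →ₗ[R] Module.Dual R F) (Q : F →ₗ[R] Module.Dual R D) (e : Fin n → F)
    (e' : Fin n → D) :
    ExteriorAlgebra R F ⊗[R] ExteriorAlgebra R D →ₗ[R]
      ExteriorAlgebra R F ⊗[R] ExteriorAlgebra R D :=
  ∑ i, TensorProduct.map (contr (P (e' i))) (contr (Q (e i)))

theorem koszul_tmul (a : ExteriorAlgebra R F) (β : ExteriorAlgebra R D) :
    koszul P Q e e' (a ⊗ₜ β) = ∑ i, contr (P (e' i)) a ⊗ₜ contr (Q (e i)) β := by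
  simp [koszul]

/-- The terms `(i, j)` and `(j, i)` of `K²` agree, since exchanging two contractions changes the
sign in both tensor factors. Collecting them over `i < j` makes the dual family of degree two usable
without dividing by `2`. -/
theorem koszul_koszul_tmul (a : ExteriorAlgebra R F) (β : ExteriorAlgebra R D) :
    koszul P Q e e' (koszul P Q e e' (a ⊗ₜ β)) = (2 : R) • ∑ k : Fin n × Fin n with k.1 < k.2,
      act P (ExteriorAlgebra.ι R (e' k.1) * ExteriorAlgebra.ι R (e' k.2)) a ⊗ₜ[R]
        act Q (ExteriorAlgebra.ι R (e k.1) * ExteriorAlgebra.ι R (e k.2)) β := by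
  simp only [koszul_tmul, map_sum]
  rw [sum_sum_eq_sum_lt _ fun i => by rw [contr_contr, TensorProduct.zero_tmul], Finset.smul_sum]
  refine Finset.sum_congr rfl fun k _ => ?_
  rw [act_mul, act_mul, act_ι_apply, act_ι_apply, act_ι_apply, act_ι_apply,
    contr_comm (P (e' k.2)), contr_comm (Q (e k.2)), TensorProduct.neg_tmul, TensorProduct.tmul_neg,
    neg_neg, two_smul]

theorem koszul_tmul_contr (d : Module.Dual R D) (z : ExteriorAlgebra R F ⊗[R] ExteriorAlgebra R D) :
    koszul P Q e e' (TensorProduct.map LinearMap.id (contr d) z) =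
      -TensorProduct.map LinearMap.id (contr d) (koszul P Q e e' z) := by
  induction z using TensorProduct.induction_on with
  | zero => simp
  | add x y hx hy => simp only [map_add, hx, hy, neg_add]
  | tmul a β =>
    simp only [TensorProduct.map_tmul, koszul_tmul, map_sum, LinearMap.id_apply,
      ← Finset.sum_neg_distrib, contr_comm _ d, TensorProduct.tmul_neg]

theorem koszul_contr_tmul (d : Module.Dual R F) (z : ExteriorAlgebra R F ⊗[R] ExteriorAlgebra R D) :
    koszul P Q e e' (TensorProduct.map (contr d) LinearMap.id z) =
      -TensorProduct.map (contr d) LinearMap.id (koszul P Q e e' z) := by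
  induction z using TensorProduct.induction_on with
  | zero => simp
  | add x y hx hy => simp only [map_add, hx, hy, neg_add]
  | tmul a β =>
    simp only [TensorProduct.map_tmul, koszul_tmul, map_sum, LinearMap.id_apply,
      ← Finset.sum_neg_distrib, contr_comm _ d, TensorProduct.neg_tmul]

/-- Contracting `(⋀Y)a` by `e i` brings in `Z (e i)`, while `N_Y (e j (β))` brings in `Y (e j)`.
Expanded in the `e' j`, these have transposed matrices (`h2`), so the two double sums coincide. -/
theorem koszul_minorMap_tmul_map (hQ : Q = P.flip) {η : ExteriorAlgebra R F}
    (hη : ∀ y, ExteriorAlgebra.ι R y * η = 0) {Y Z : F →ₗ[R] D} (h : ∀ m, P (Z m) = Q m ∘ₗ Y)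
    (he' : ∀ y, ∑ i, Q (e i) y • e' i = y) (a : ExteriorAlgebra R F) (β : ExteriorAlgebra R D) :
    koszul P Q e e' (minorMap P η Y β ⊗ₜ ExteriorAlgebra.map Y a) =
      ∑ i, minorMap P η Y (contr (Q (e i)) β) ⊗ₜ ExteriorAlgebra.map Y (contr (P (e' i)) a) := by
  have h1 : ∀ (Y : F →ₗ[R] D) (m) (x : ExteriorAlgebra R F),
      contr (P (Y m)) x = ∑ j, Q (e j) (Y m) • contr (P (e' j)) x := by
    intro Y m x
    conv_lhs => rw [← he' (Y m), map_sum, contr_sum]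
    simp only [map_smul, contr_smul]
  have h2 : ∀ i j, Q (e i) (Z (e j)) = Q (e j) (Y (e i)) := fun i j => by
    rw [hQ, LinearMap.flip_apply, h, hQ]; rfl
  rw [koszul_tmul]
  calc _ = ∑ i, ∑ j, Q (e j) (Z (e i)) •
        contr (P (e' i)) (minorMap P η Y β) ⊗ₜ ExteriorAlgebra.map Y (contr (P (e' j)) a) := by
        refine Finset.sum_congr rfl fun i _ => ?_
        rw [← map_contr, ← h, h1, map_sum, TensorProduct.tmul_sum]
        simp only [map_smul, TensorProduct.tmul_smul, TensorProduct.smul_tmul']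
    _ = _ := by
        rw [Finset.sum_comm]
        refine Finset.sum_congr rfl fun j _ => ?_
        have := minorMap_act hQ hη Y (ExteriorAlgebra.ι R (e j)) β
        rw [act_ι_apply, ExteriorAlgebra.map_apply_ι, act_ι_apply, h1] at this
        rw [this, TensorProduct.sum_tmul]
        simp only [h2, TensorProduct.smul_tmul']

end Duality

/-! ### The formal differential: operators, relations, square zero -/

/-- Four modules `A₁, A₂, A₂, A₁` with the operators that make up the differential. -/
structure MergedOps (R A₁ A₂ : Type*) [CommRing R] [AddCommGroup A₁] [Module R A₁]
    [AddCommGroup A₂] [Module R A₂] where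
  V : A₁ →ₗ[R] A₁
  U : A₁ →ₗ[R] A₁
  V₂ : A₂ →ₗ[R] A₂
  U₂ : A₂ →ₗ[R] A₂
  V₃ : A₂ →ₗ[R] A₂
  U₃ : A₂ →ₗ[R] A₂
  K : A₂ →ₗ[R] A₂
  x : A₂ →ₗ[R] A₁
  y : A₂ →ₗ[R] A₁
  N₂ : A₁ →ₗ[R] A₂
  N₃ : A₁ →ₗ[R] A₂

namespace MergedOps

variable {R A₁ A₂ : Type*} [CommRing R] [AddCommGroup A₁] [Module R A₁]
  [AddCommGroup A₂] [Module R A₂]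

/-- The relations between the operators. -/
structure Relations (O : MergedOps R A₁ A₂) : Prop where
  VV : ∀ z, O.V (O.V z) = 0
  UU : ∀ z, O.U (O.U z) = 0
  UV : ∀ z, O.U (O.V z) = O.V (O.U z)
  VV₂ : ∀ z, O.V₂ (O.V₂ z) = 0
  UU₂ : ∀ z, O.U₂ (O.U₂ z) = 0
  UV₂ : ∀ z, O.U₂ (O.V₂ z) = O.V₂ (O.U₂ z)
  VV₃ : ∀ z, O.V₃ (O.V₃ z) = 0
  UU₃ : ∀ z, O.U₃ (O.U₃ z) = 0
  UV₃ : ∀ z, O.U₃ (O.V₃ z) = O.V₃ (O.U₃ z)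
  KV₂ : ∀ z, O.K (O.V₂ z) = -O.V₂ (O.K z)
  KU₂ : ∀ z, O.K (O.U₂ z) = -O.U₂ (O.K z)
  KV₃ : ∀ z, O.K (O.V₃ z) = -O.V₃ (O.K z)
  KU₃ : ∀ z, O.K (O.U₃ z) = -O.U₃ (O.K z)
  xV : ∀ z, O.x (O.V₂ z) = O.V (O.x z)
  xU : ∀ z, O.x (O.U₂ z) = O.U (O.x z)
  yV : ∀ z, O.y (O.V₃ z) = O.V (O.y z)
  yU : ∀ z, O.y (O.U₃ z) = O.U (O.y z)
  NV₂ : ∀ z, O.N₂ (O.V z) = O.V₂ (O.N₂ z)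
  NU₂ : ∀ z, O.N₂ (O.U z) = O.U₂ (O.N₂ z)
  NV₃ : ∀ z, O.N₃ (O.V z) = O.V₃ (O.N₃ z)
  NU₃ : ∀ z, O.N₃ (O.U z) = O.U₃ (O.N₃ z)
  KNx₂ : ∀ z, O.K (O.N₂ (O.x z)) = O.N₂ (O.x (O.K z))
  KNy₂ : ∀ z, O.K (O.N₂ (O.y z)) = O.N₂ (O.y (O.K z))
  KNx₃ : ∀ z, O.K (O.N₃ (O.x z)) = O.N₃ (O.x (O.K z))
  KNy₃ : ∀ z, O.K (O.N₃ (O.y z)) = O.N₃ (O.y (O.K z))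
  xN : ∀ z, O.x (O.N₂ z) = O.y (O.N₃ z)
  xKN : ∀ z, O.x (O.K (O.N₂ z)) = O.y (O.K (O.N₃ z))
  xKKN : ∀ z, O.x (O.K (O.K (O.N₂ z))) = O.y (O.K (O.K (O.N₃ z)))

variable (O : MergedOps R A₁ A₂) (s : R)

/-- The restriction of the differential to the first summand. -/
def d₁ : A₁ →ₗ[R] A₁ × A₂ × A₂ × A₁ :=
  (O.V + s • O.U).prod ((O.K ∘ₗ O.N₂).prod ((O.K ∘ₗ O.N₃).prod 0))

/-- The restriction of the differential to the second summand. -/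
def d₂ : A₂ →ₗ[R] A₁ × A₂ × A₂ × A₁ :=
  (s • O.x).prod ((O.V₂ - s • O.U₂).prod (LinearMap.prod 0 (O.x ∘ₗ O.K)))

/-- The restriction of the differential to the third summand. -/
def d₃ : A₂ →ₗ[R] A₁ × A₂ × A₂ × A₁ :=
  (-(s • O.y)).prod (LinearMap.prod 0 ((O.V₃ - s • O.U₃).prod (-(O.y ∘ₗ O.K))))

/-- The restriction of the differential to the fourth summand. -/
def d₄ : A₁ →ₗ[R] A₁ × A₂ × A₂ × A₁ :=
  LinearMap.prod 0 ((s • O.N₂).prod ((s • O.N₃).prod (O.V + s • O.U)))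

/-- The differential with sign `s`. -/
def d : A₁ × A₂ × A₂ × A₁ →ₗ[R] A₁ × A₂ × A₂ × A₁ :=
  (O.d₁ s).coprod ((O.d₂ s).coprod ((O.d₃ s).coprod (O.d₄ s)))

variable {O s}

theorem d₁_apply (z : A₁) : O.d₁ s z = (O.V z + s • O.U z, O.K (O.N₂ z), O.K (O.N₃ z), 0) := rfl

theorem d₂_apply (z : A₂) : O.d₂ s z = (s • O.x z, O.V₂ z - s • O.U₂ z, 0, O.x (O.K z)) := rfl

theorem d₃_apply (z : A₂) :
    O.d₃ s z = (-(s • O.y z), 0, O.V₃ z - s • O.U₃ z, -O.y (O.K z)) := rfl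

theorem d₄_apply (z : A₁) : O.d₄ s z = (0, s • O.N₂ z, s • O.N₃ z, O.V z + s • O.U z) := rfl

theorem d_apply (z : A₁ × A₂ × A₂ × A₁) :
    O.d s z = O.d₁ s z.1 + (O.d₂ s z.2.1 + (O.d₃ s z.2.2.1 + O.d₄ s z.2.2.2)) := rfl

/-- The sign alternates because `U` and `V` commute: `(V - sU)(V + sU) = 0` uses `V² = U² = 0`.
Terms with one `K` cancel by anticommutation or by `x K N₂ = y K N₃`, and `x K² N₂ - y K² N₃` is the
entry from the first summand to the fourth. -/
theorem d_neg_d (h : O.Relations) (hs : s = 1 ∨ s = -1) (z : A₁ × A₂ × A₂ × A₁) :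
    O.d (-s) (O.d s z) = 0 := by
  obtain ⟨z₁, z₂, z₃, z₄⟩ := z
  rcases hs with rfl | rfl <;>
  -- With `s = ±1` substituted no scalars remain, and the relations, read from left to right, bring
  -- all words to a form in which they cancel additively.
  · simp only [d_apply, d₁_apply, d₂_apply, d₃_apply, d₄_apply, map_add, map_sub, map_neg,
      map_zero, one_smul, neg_smul, neg_neg, Prod.mk_add_mk, h.VV, h.UU, h.UV, h.VV₂, h.UU₂, h.UV₂,
      h.VV₃, h.UU₃, h.UV₃, h.KV₂, h.KU₂, h.KV₃, h.KU₃, h.xV, h.xU, h.yV, h.yU, h.NV₂, h.NU₂, h.NV₃,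
      h.NU₃, h.KNx₂, h.KNy₂, h.KNx₃, h.KNy₃, h.xN, h.xKN, h.xKKN]
    refine Prod.ext ?_ (Prod.ext ?_ (Prod.ext ?_ ?_)) <;>
    simp only [Prod.fst_zero, Prod.snd_zero, Prod.fst_add, Prod.snd_add, Prod.fst_neg,
      Prod.snd_neg, Prod.fst_sub, Prod.snd_sub] <;> abel

end MergedOps

/-! ### The relations hold on tensor products of exterior algebras -/

section Ungraded

variable {R F D : Type*} [CommRing R] [AddCommGroup F] [Module R F] [AddCommGroup D] [Module R D]
  {n : ℕ}

/-- The operators of the merged Koszul complex on tensor products of exterior algebras. -/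
def ops (P : D →ₗ[R] Module.Dual R F) (Q : F →ₗ[R] Module.Dual R D) (η : ExteriorAlgebra R F)
    (e : Fin n → F) (e' : Fin n → D) (X Z : F →ₗ[R] D) (u v : F) :
    MergedOps R (ExteriorAlgebra R D ⊗[R] ExteriorAlgebra R D)
      (ExteriorAlgebra R F ⊗[R] ExteriorAlgebra R D) where
  V := TensorProduct.map LinearMap.id (contr (Q v))
  U := TensorProduct.map (contr (Q u)) LinearMap.id
  V₂ := TensorProduct.map LinearMap.id (contr (Q v))
  U₂ := TensorProduct.map (contr (P (Z u))) LinearMap.id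
  V₃ := TensorProduct.map (contr (P (X v))) LinearMap.id
  U₃ := TensorProduct.map LinearMap.id (contr (Q u))
  K := koszul P Q e e'
  x := TensorProduct.map (ExteriorAlgebra.map X).toLinearMap LinearMap.id
  y := (TensorProduct.comm R _ _).toLinearMap ∘ₗ
    TensorProduct.map (ExteriorAlgebra.map Z).toLinearMap LinearMap.id
  N₂ := TensorProduct.map (minorMap P η Z) LinearMap.id
  N₃ := TensorProduct.map (minorMap P η X) LinearMap.id ∘ₗ (TensorProduct.comm R _ _).toLinearMap

theorem ops_relations {P : D →ₗ[R] Module.Dual R F} {Q : F →ₗ[R] Module.Dual R D}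
    (hQ : Q = P.flip) {η : ExteriorAlgebra R F} (hηn : η ∈ ⋀[R]^n F)
    (hη : ∀ y, ExteriorAlgebra.ι R y * η = 0) {ε : ExteriorAlgebra R D}
    (hε : ∀ y, ExteriorAlgebra.ι R y * ε = 0) (hηε : act Q η ε = 1) {e : Fin n → F}
    {e' : Fin n → D} (he : ∀ x, ∑ i, P (e' i) x • e i = x)
    (he' : ∀ y, ∑ i, Q (e i) y • e' i = y) {X Z : F →ₗ[R] D}
    (hX : ∀ m, P (X m) = Q m ∘ₗ Z) (hZ : ∀ m, P (Z m) = Q m ∘ₗ X) (u v : F) :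
    (ops P Q η e e' X Z u v).Relations := by
  have hX' : ∀ (w : F) (a : ExteriorAlgebra R F), ExteriorAlgebra.map X (contr (P (Z w)) a) =
      contr (Q w) (ExteriorAlgebra.map X a) := fun w a => by rw [hZ, map_contr]
  have hZ' : ∀ (w : F) (a : ExteriorAlgebra R F), ExteriorAlgebra.map Z (contr (P (X w)) a) =
      contr (Q w) (ExteriorAlgebra.map Z a) := fun w a => by rw [hX, map_contr]
  have hm : ∀ (Y : F →ₗ[R] D) (w : F) (α : ExteriorAlgebra R D),
      minorMap P η Y (contr (Q w) α) = contr (P (Y w)) (minorMap P η Y α) := fun Y w α => by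
    have := minorMap_act hQ hη Y (ExteriorAlgebra.ι R w) α
    rwa [act_ι_apply, ExteriorAlgebra.map_apply_ι, act_ι_apply] at this
  obtain ⟨r, hr⟩ := exists_minorMap_map hQ hηn hη hX
  obtain ⟨r', hr'⟩ := exists_minorMap_map hQ hηn hη hZ
  -- `h0`, `h1`, `h2` use the dual families of degrees `0`, `1`, `2`; they give `xN`, `xKN`, `xKKN`.
  have h0 := sum_map_act_minorMap_tmul hQ hηn hε hηε hX hZ (s := {()}) (γ := fun _ => 1)
    (g := fun _ => 1) (p := 0) (c := 1)
    (fun _ _ => by simpa using algebraMap_mem_Pow (M := D) (1 : R))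
    (fun x hx => eq_scal_of_mem_zero hx)
  have h1 := sum_map_act_minorMap_tmul hQ hηn hε hηε hX hZ
    (γ := fun i => ExteriorAlgebra.ι R (e' i)) (fun _ _ => ι_mem_Pow _)
    (fun x hx => eq_sum_of_mem_one he hx)
  have h2 := sum_map_act_minorMap_tmul hQ hηn hε hηε hX hZ
    (γ := fun k : Fin n × Fin n => ExteriorAlgebra.ι R (e' k.1) * ExteriorAlgebra.ι R (e' k.2))
    (fun _ _ => mul_mem_Pow (by norm_num) (ι_mem_Pow _) (ι_mem_Pow _))
    (fun x hx => eq_sum_of_mem_two he hx)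
  refine ⟨?_, ?_, ?_, ?_, ?_, ?_, ?_, ?_, ?_, koszul_tmul_contr _, koszul_contr_tmul _,
    koszul_contr_tmul _, koszul_tmul_contr _, ?_, ?_, ?_, ?_, ?_, ?_, ?_, ?_, ?_, ?_, ?_, ?_, ?_,
    ?_, ?_⟩
  -- All relations are checked on pure tensors. Those between contractions, exterior powers and
  -- minor maps close at once; the seven left are the `KN` relations, which use the scalars `r`,
  -- `r'` or `koszul_minorMap_tmul_map`, and the three duality relations.
  all_goals
    refine fun z => TensorProduct.induction_on z (by simp only [map_zero]) (fun a β => ?_)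
      fun z w hz hw => by simp only [map_add, hz, hw, add_zero]
    simp only [ops, TensorProduct.map_tmul, LinearMap.comp_apply, LinearMap.id_apply,
      LinearEquiv.coe_coe, TensorProduct.comm_tmul, AlgHom.toLinearMap_apply, contr_contr,
      TensorProduct.tmul_zero, TensorProduct.zero_tmul, hX', hZ', hm]
  · simp only [hr, koszul_tmul, map_sum, map_smul,
      TensorProduct.map_tmul, AlgHom.toLinearMap_apply, LinearMap.id_apply]
  · simp only [koszul_minorMap_tmul_map hQ hη hX he', koszul_tmul, map_sum, TensorProduct.map_tmul,
      AlgHom.toLinearMap_apply, LinearMap.id_apply, TensorProduct.comm_tmul]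
  · simp only [koszul_minorMap_tmul_map hQ hη hZ he', koszul_tmul, map_sum, TensorProduct.map_tmul,
      AlgHom.toLinearMap_apply, LinearMap.id_apply, TensorProduct.comm_tmul]
  · simp only [hr', koszul_tmul, map_sum, map_smul,
      TensorProduct.map_tmul, AlgHom.toLinearMap_apply, LinearMap.id_apply, TensorProduct.comm_tmul]
  · simpa only [Finset.sum_singleton, map_one, Module.End.one_apply] using h0 a β
  · simpa only [koszul_tmul, map_sum, TensorProduct.map_tmul, AlgHom.toLinearMap_apply,
      LinearMap.id_apply, TensorProduct.comm_tmul, act_ι_apply] using h1 a β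
  · simpa only [koszul_koszul_tmul, map_sum, map_smul, TensorProduct.map_tmul,
      AlgHom.toLinearMap_apply, LinearMap.id_apply, TensorProduct.comm_tmul] using
      congrArg ((2 : R) • ·) (h2 a β)

end Ungraded

/-! ### The component of bidegree `(1, t-1)` of co-multiplication -/

section Comultiplication

variable {R M : Type*} [CommRing R] [AddCommGroup M] [Module R M]

theorem coe_projPow_natCast (k : ℕ) (x : ExteriorAlgebra R M) :
    (projPow R M k x : ExteriorAlgebra R M) =
      (DirectSum.decompose (fun i : ℕ => ⋀[R]^i M) x k : ExteriorAlgebra R M) := rfl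

theorem projPow_of_mem {k : ℤ} {x : ExteriorAlgebra R M} (hx : x ∈ ExtPow R M k) :
    (projPow R M k x : ExteriorAlgebra R M) = x := by
  rcases k with k | k
  · exact (coe_projPow_natCast k x).trans (DirectSum.decompose_of_mem_same _ hx)
  · rw [show x = 0 from hx, map_zero, ZeroMemClass.coe_zero]

theorem projPow_of_mem_ne {k l : ℤ} (h : k ≠ l) {x : ExteriorAlgebra R M}
    (hx : x ∈ ExtPow R M k) : projPow R M l x = 0 := by
  refine Subtype.ext ?_
  rcases l with l | l
  · rcases k with k | k
    · exact (coe_projPow_natCast l x).trans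
        (DirectSum.decompose_of_mem_ne _ hx fun h' => h (congrArg Int.ofNat h'))
    · rw [show x = 0 from hx, map_zero]
  · rfl

theorem projPow_ι_mul (k : ℤ) (m : M) (x : ExteriorAlgebra R M) :
    (projPow R M (k + 1) (ExteriorAlgebra.ι R m * x) : ExteriorAlgebra R M) =
      ExteriorAlgebra.ι R m * projPow R M k x := by
  induction x using homogeneous_induction with
  | hadd x y hx hy => simp only [mul_add, map_add, Submodule.coe_add, hx, hy]
  | h l x hx =>
    have hmx : ExteriorAlgebra.ι R m * x ∈ ExtPow R M (l + 1) :=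
      mul_mem_Pow (add_comm _ _) (ι_mem_Pow m) hx
    rcases eq_or_ne l k with rfl | h
    · rw [projPow_of_mem hmx, projPow_of_mem hx]
    · rw [projPow_of_mem_ne (fun h' => h (add_right_cancel h')) hmx, projPow_of_mem_ne h hx]
      exact (mul_zero _).symm

variable (R M) in
/-- The projection of the exterior algebra to the component of degree `k`. -/
def projSub (k : ℤ) : ExteriorAlgebra R M →ₗ[R] ExteriorAlgebra R M :=
  (ExtPow R M k).subtype ∘ₗ projPow R M k

variable (R M) in
/-- Co-multiplication, with values in the ordinary tensor product. -/
def comulT : ExteriorAlgebra R M →ₗ[R] ExteriorAlgebra R M ⊗[R] ExteriorAlgebra R M :=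
  (GradedTensorProduct.of R (fun i : ℕ => ⋀[R]^i M) (fun i : ℕ => ⋀[R]^i M)).symm.toLinearMap ∘ₗ
    (comul R M).toLinearMap

theorem comulT_algebraMap (r : R) : comulT R M (algebraMap R _ r) = algebraMap R _ r ⊗ₜ 1 := by
  change (GradedTensorProduct.of R (fun i : ℕ => ⋀[R]^i M) (fun i : ℕ => ⋀[R]^i M)).symm
    (comul R M (algebraMap R _ r)) = _
  rw [AlgHom.commutes]
  rfl

theorem uzpow_smul_eq {A : Type*} [AddCommGroup A] [Module R A] (k : ℕ) (z : A) :
    ((-1 : ℤˣ) ^ k) • z = sgn R k • z := by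
  rcases Nat.even_or_odd k with h | h
  · simp [sgn, h.neg_one_pow, Int.negOnePow_even _ (Int.even_coe_nat k |>.2 h)]
  · simp [sgn, h.neg_one_pow, Int.negOnePow_odd _ (Int.odd_coe_nat k |>.2 h)]

/-- This is `Δ(m ∧ x) = (m ⊗ 1 + 1 ⊗ m) Δ(x)` in the ordinary tensor product: moving `m` past the
left factor produces the grading involution there. -/
theorem comulT_ι_mul (m : M) (x : ExteriorAlgebra R M) :
    comulT R M (ExteriorAlgebra.ι R m * x) =
      TensorProduct.map (LinearMap.mulLeft R (ExteriorAlgebra.ι R m)) LinearMap.id (comulT R M x) +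
      TensorProduct.map (invol R M).toLinearMap (LinearMap.mulLeft R (ExteriorAlgebra.ι R m))
        (comulT R M x) := by
  have hm : ExteriorAlgebra.ι R m ∈ ⋀[R]^1 M := ι_mem_Pow (R := R) m
  have h0 : comul R M (ExteriorAlgebra.ι R m) =
      (ExteriorAlgebra.ι R m) ᵍ⊗ₜ[R] 1 + 1 ᵍ⊗ₜ[R] (ExteriorAlgebra.ι R m) :=
    ExteriorAlgebra.lift_ι_apply R _ _ m
  have h1 : ∀ z : ExteriorAlgebra R M ⊗[R] ExteriorAlgebra R M,
      comul R M (ExteriorAlgebra.ι R m) * GradedTensorProduct.of R (fun i : ℕ => ⋀[R]^i M)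
        (fun i : ℕ => ⋀[R]^i M) z = GradedTensorProduct.of R _ _
      (TensorProduct.map (LinearMap.mulLeft R (ExteriorAlgebra.ι R m)) LinearMap.id z +
      TensorProduct.map (invol R M).toLinearMap (LinearMap.mulLeft R (ExteriorAlgebra.ι R m)) z) := by
    intro z
    induction z using TensorProduct.induction_on with
    | zero => simp only [map_zero, mul_zero, add_zero]
    | add x y hx hy =>
      rw [map_add, mul_add, hx, hy]
      simp only [map_add]
      abel
    | tmul a b =>
      induction a using homogeneous_induction with
      | hadd x y hx hy =>
        simp only [TensorProduct.add_tmul, map_add, mul_add] at hx hy ⊢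
        rw [hx, hy]
        abel
      | h k a ha =>
        rcases k with k | k
        · have h2 := GradedTensorProduct.tmul_one_mul_coe_tmul (R := R) (fun i : ℕ => ⋀[R]^i M)
            (fun i : ℕ => ⋀[R]^i M) (ExteriorAlgebra.ι R m) ⟨a, ha⟩ b
          have h3 := GradedTensorProduct.tmul_coe_mul_coe_tmul (R := R) (fun i : ℕ => ⋀[R]^i M)
            (fun i : ℕ => ⋀[R]^i M) 1 ⟨_, hm⟩ ⟨a, ha⟩ b
          rw [one_mul, one_mul, uzpow_smul_eq (R := R)] at h3
          rw [h0, add_mul, TensorProduct.map_tmul, TensorProduct.map_tmul, AlgHom.toLinearMap_apply,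
            invol_of_mem ha, map_add]
          refine congrArg₂ (· + ·) h2 (h3.trans ?_)
          rw [← map_smul, TensorProduct.smul_tmul']
          rfl
        · rw [show a = 0 from ha]
          simp only [TensorProduct.zero_tmul, map_zero, mul_zero, add_zero]
  change (GradedTensorProduct.of R (fun i : ℕ => ⋀[R]^i M) (fun i : ℕ => ⋀[R]^i M)).symm
    (comul R M (ExteriorAlgebra.ι R m * x)) = _
  rw [map_mul, LinearEquiv.symm_apply_eq]
  exact h1 (comulT R M x)

theorem projSub_add_one_comulT_ι_mul (k : ℤ) (m : M) (x : ExteriorAlgebra R M) :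
    TensorProduct.map (projSub R M (k + 1)) LinearMap.id (comulT R M (ExteriorAlgebra.ι R m * x)) =
      TensorProduct.map (LinearMap.mulLeft R (ExteriorAlgebra.ι R m)) LinearMap.id
        (TensorProduct.map (projSub R M k) LinearMap.id (comulT R M x)) +
      sgn R (k + 1) • TensorProduct.map LinearMap.id (LinearMap.mulLeft R (ExteriorAlgebra.ι R m))
        (TensorProduct.map (projSub R M (k + 1)) LinearMap.id (comulT R M x)) := by
  have h1 : ∀ a, projSub R M (k + 1) (ExteriorAlgebra.ι R m * a) =
      ExteriorAlgebra.ι R m * projSub R M k a := projPow_ι_mul k m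
  have h2 : ∀ l a, projSub R M l (invol R M a) = sgn R l • projSub R M l a := by
    intro l a
    induction a using homogeneous_induction with
    | hadd x y hx hy => simp only [map_add, smul_add, hx, hy]
    | h i a ha =>
      rw [invol_of_mem ha, map_smul]
      rcases eq_or_ne i l with rfl | h
      · rfl
      · simp only [projSub, LinearMap.comp_apply, projPow_of_mem_ne h ha, map_zero, smul_zero]
  rw [comulT_ι_mul, map_add]
  generalize comulT R M x = z
  induction z using TensorProduct.induction_on with
  | zero => simp only [map_zero, smul_zero, add_zero]
  | add z w hz hw =>
    simp only [map_add, smul_add]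
    rw [add_add_add_comm, hz, hw]
    abel
  | tmul a b =>
    simp only [TensorProduct.map_tmul, LinearMap.mulLeft_apply, LinearMap.id_apply, h1, h2,
      AlgHom.toLinearMap_apply, TensorProduct.smul_tmul']

theorem projSub_zero_comulT (x : ExteriorAlgebra R M) :
    TensorProduct.map (projSub R M 0) LinearMap.id (comulT R M x) = 1 ⊗ₜ x := by
  induction x using ext_induction with
  | h0 r =>
    have : projSub R M 0 (algebraMap R _ r) = algebraMap R _ r :=
      projPow_of_mem (algebraMap_mem_Pow r)
    rw [comulT_algebraMap, TensorProduct.map_tmul, this, Algebra.algebraMap_eq_smul_one,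
      TensorProduct.smul_tmul]
    rfl
  | h1 x y hx hy => rw [map_add, map_add, hx, hy, TensorProduct.tmul_add]
  | h2 x m hx =>
    -- The recursion is started in degree `-1`, where the projection is zero, so that only the term
    -- with `m` on the right survives.
    have h := projSub_add_one_comulT_ι_mul (-1) m x
    have h' : projSub R M (-1) = 0 := LinearMap.comp_zero _
    rw [neg_add_cancel, hx, h', TensorProduct.map_zero_left, LinearMap.zero_apply, map_zero,
      zero_add, sgn_zero, one_smul] at h
    exact h

/-- Both sides satisfy the same recursion: `Δ₁(m ∧ x) = m ⊗ x - (1 ⊗ m) Δ₁(x)` matches the Leibniz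
rule for the contractions by `e' i` once `m` is expanded in the `e i`. -/
theorem projSub_one_comulT {n : ℕ} {e : Fin n → M} {e' : Fin n → Module.Dual R M}
    (he : ∀ x, ∑ i, e' i x • e i = x) (x : ExteriorAlgebra R M) :
    TensorProduct.map (projSub R M 1) LinearMap.id (comulT R M x) =
      ∑ i, ExteriorAlgebra.ι R (e i) ⊗ₜ contr (e' i) x := by
  induction x using ext_induction with
  | h0 r =>
    have : projSub R M 1 (algebraMap R _ r) = 0 :=
      congrArg Subtype.val (projPow_of_mem_ne (by decide) (algebraMap_mem_Pow r))
    rw [comulT_algebraMap, TensorProduct.map_tmul, this, TensorProduct.zero_tmul]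
    simp only [contr_algebraMap, TensorProduct.tmul_zero, Finset.sum_const_zero]
  | h1 x y hx hy =>
    simp only [map_add, hx, hy, TensorProduct.tmul_add, Finset.sum_add_distrib]
  | h2 x m hx =>
    have h := projSub_add_one_comulT_ι_mul 0 m x
    have hneg : ∀ z : ExteriorAlgebra R M ⊗[R] ExteriorAlgebra R M, (-1 : R) • z = -z :=
      fun z => neg_one_smul R z
    rw [zero_add, projSub_zero_comulT, hx, ← zero_add (1 : ℤ), sgn_add_one, sgn_zero,
      zero_add, hneg, TensorProduct.map_tmul, LinearMap.mulLeft_apply, mul_one,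
      LinearMap.id_apply, map_sum, ← sub_eq_add_neg] at h
    rw [h]
    conv_lhs => enter [1]; rw [← he m, map_sum, TensorProduct.sum_tmul]
    rw [← Finset.sum_sub_distrib]
    refine Finset.sum_congr rfl fun i _ => ?_
    rw [contr_ι_mul, TensorProduct.tmul_sub, TensorProduct.tmul_smul, TensorProduct.smul_tmul',
      map_smul, TensorProduct.map_tmul]
    rfl

theorem comulPow_one {n : ℕ} {e : Fin n → M} {e' : Fin n → Module.Dual R M}
    (he : ∀ x, ∑ i, e' i x • e i = x) (t : ℤ) (x : ExtPow R M t) :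
    comulPow t 1 (t - 1) x = ∑ i, (⟨ExteriorAlgebra.ι R (e i), ι_mem_Pow _⟩ : ExtPow R M 1) ⊗ₜ
      contractPow (e' i) t x := by
  have h := congrArg (TensorProduct.map (projPow R M 1) (projPow R M (t - 1)))
    (projSub_one_comulT he (x : ExteriorAlgebra R M))
  have h1 : projPow R M 1 ∘ₗ projSub R M 1 = projPow R M 1 :=
    LinearMap.ext fun y => Subtype.ext (projPow_of_mem (projPow R M 1 y).2)
  rw [← LinearMap.comp_apply, ← TensorProduct.map_comp, h1, LinearMap.comp_id] at h
  refine h.trans ?_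
  rw [map_sum]
  refine Finset.sum_congr rfl fun i _ => ?_
  rw [TensorProduct.map_tmul]
  exact congrArg₂ _ (Subtype.ext (projPow_of_mem (ι_mem_Pow _)))
    (Subtype.ext (projPow_of_mem (contr_mem x.2)))

end Comultiplication

/-! ### Embedding a graded piece in the full tensor product -/

section Total

variable {R M N : Type*} [CommRing R] [AddCommGroup M] [Module R M] [AddCommGroup N] [Module R N]

variable (R M N) in
/-- The inclusion of `⋀ᵗ M ⊗ ⋀ˢ N` in `⋀ M ⊗ ⋀ N`. -/
def incl (t s : ℤ) :
    ExtPow R M t ⊗[R] ExtPow R N s →ₗ[R] ExteriorAlgebra R M ⊗[R] ExteriorAlgebra R N :=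
  TensorProduct.map (ExtPow R M t).subtype (ExtPow R N s).subtype

theorem incl_tmul (t s : ℤ) (x : ExtPow R M t) (y : ExtPow R N s) :
    incl R M N t s (x ⊗ₜ y) = (x : ExteriorAlgebra R M) ⊗ₜ (y : ExteriorAlgebra R N) := rfl

variable (R M N) in
/-- The inclusion of `⨁ₜ ⋀ᵗ M ⊗ ⋀ᶜ⁻ᵗ N` in `⋀ M ⊗ ⋀ N`. -/
def total (c : ℤ) : (⨁ t : ℤ, ExtPow R M t ⊗[R] ExtPow R N (c - t)) →ₗ[R]
    ExteriorAlgebra R M ⊗[R] ExteriorAlgebra R N :=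
  DirectSum.toModule R ℤ _ fun t => incl R M N t (c - t)

theorem total_lof (c t : ℤ) (z : ExtPow R M t ⊗[R] ExtPow R N (c - t)) :
    total R M N c (DirectSum.lof R ℤ (fun t => ExtPow R M t ⊗[R] ExtPow R N (c - t)) t z) =
      incl R M N t (c - t) z := by
  unfold total
  rw [DirectSum.toModule_lof]

theorem total_lof_castPow (c t s : ℤ) (h : s = c - t) (z : ExtPow R M t ⊗[R] ExtPow R N s) :
    total R M N c (DirectSum.lof R ℤ (fun t => ExtPow R M t ⊗[R] ExtPow R N (c - t)) t
      (TensorProduct.map LinearMap.id (castPow h) z)) = incl R M N t s z := by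
  subst h
  rw [total_lof]
  have : castPow (R := R) (M := N) (rfl : c - t = c - t) = LinearMap.id := rfl
  rw [this, TensorProduct.map_id, LinearMap.id_apply]

/-- Projecting to bidegree `(k, c - k)` recovers the `k`-th component, so no flatness of the
exterior powers is needed. -/
theorem total_injective (c : ℤ) : Function.Injective (total R M N c) := by
  have hcomp : ∀ k, TensorProduct.map (projPow R M k) (projPow R N (c - k)) ∘ₗ total R M N c =
      DirectSum.component R ℤ (fun t => ExtPow R M t ⊗[R] ExtPow R N (c - t)) k := by
    intro k
    refine DirectSum.linearMap_ext R fun t => TensorProduct.ext' fun x y => ?_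
    rw [LinearMap.comp_apply, LinearMap.comp_apply, LinearMap.comp_apply, total_lof, incl_tmul,
      TensorProduct.map_tmul]
    rcases eq_or_ne t k with rfl | h
    · rw [DirectSum.component.lof_self]
      exact congrArg₂ _ (Subtype.ext (projPow_of_mem x.2)) (Subtype.ext (projPow_of_mem y.2))
    · rw [projPow_of_mem_ne h x.2, TensorProduct.zero_tmul, DirectSum.component.of, dif_neg h]
  intro z w h
  refine DFinsupp.ext fun k => ?_
  have hz := LinearMap.congr_fun (hcomp k) z
  have hw := LinearMap.congr_fun (hcomp k) w
  rw [LinearMap.comp_apply] at hz hw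
  exact hz.symm.trans ((congrArg _ h).trans hw)

end Total

/-! ### Comparing the graded maps with the ungraded operators -/

section Comparison

variable {R F : Type*} [CommRing R] [AddCommGroup F] [Module R F]

variable (R F) in
/-- The inclusion of `𝔽ᵣ` in the ungraded total module. -/
def toUngraded (r : ℤ) : FF R F r →ₗ[R]
    (ExteriorAlgebra R (Module.Dual R F) ⊗[R] ExteriorAlgebra R (Module.Dual R F)) ×
    (ExteriorAlgebra R F ⊗[R] ExteriorAlgebra R (Module.Dual R F)) ×
    (ExteriorAlgebra R F ⊗[R] ExteriorAlgebra R (Module.Dual R F)) ×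
    (ExteriorAlgebra R (Module.Dual R F) ⊗[R] ExteriorAlgebra R (Module.Dual R F)) :=
  LinearMap.prodMap (total R (Module.Dual R F) (Module.Dual R F) (r + 1) : F1 R F r →ₗ[R] _)
    (LinearMap.prodMap (total R F (Module.Dual R F) r : F2 R F r →ₗ[R] _)
      (LinearMap.prodMap (total R F (Module.Dual R F) r : F3 R F r →ₗ[R] _)
        (total R (Module.Dual R F) (Module.Dual R F) (r - 1) : F4 R F r →ₗ[R] _)))

theorem toUngraded_injective (r : ℤ) : Function.Injective (toUngraded R F r) :=
  (total_injective (r + 1)).prodMap ((total_injective r).prodMap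
    ((total_injective r).prodMap (total_injective (r - 1))))

theorem toUngraded_in1 (r t s : ℤ) (h : s + t = r + 1) (z) :
    toUngraded R F r (in1 r t s h z) = (incl R _ _ t s z, 0, 0, 0) :=
  Prod.ext (total_lof_castPow (r + 1) t s _ z) (Prod.ext
    (map_zero (total R F (Module.Dual R F) r)) (Prod.ext (map_zero (total R F (Module.Dual R F) r))
    (map_zero (total R (Module.Dual R F) (Module.Dual R F) (r - 1)))))

theorem toUngraded_in2 (r t s : ℤ) (h : s + t = r) (z) :
    toUngraded R F r (in2 r t s h z) = (0, incl R _ _ t s z, 0, 0) :=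
  Prod.ext (map_zero (total R (Module.Dual R F) (Module.Dual R F) (r + 1))) (Prod.ext
    (total_lof_castPow r t s _ z) (Prod.ext (map_zero (total R F (Module.Dual R F) r))
    (map_zero (total R (Module.Dual R F) (Module.Dual R F) (r - 1)))))

theorem toUngraded_in3 (r t s : ℤ) (h : s + t = r) (z) :
    toUngraded R F r (in3 r t s h z) = (0, 0, incl R _ _ t s z, 0) :=
  Prod.ext (map_zero (total R (Module.Dual R F) (Module.Dual R F) (r + 1))) (Prod.ext
    (map_zero (total R F (Module.Dual R F) r)) (Prod.ext (total_lof_castPow r t s _ z)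
    (map_zero (total R (Module.Dual R F) (Module.Dual R F) (r - 1)))))

theorem toUngraded_in4 (r t s : ℤ) (h : s + t = r - 1) (z) :
    toUngraded R F r (in4 r t s h z) = (0, 0, 0, incl R _ _ t s z) :=
  Prod.ext (map_zero (total R (Module.Dual R F) (Module.Dual R F) (r + 1))) (Prod.ext
    (map_zero (total R F (Module.Dual R F) r)) (Prod.ext (map_zero (total R F (Module.Dual R F) r))
    (total_lof_castPow (r - 1) t s _ z)))

theorem coe_evalPow (w : F) (j : ℤ) (β : ExtPow R (Module.Dual R F) j) :
    (evalPow w j β : ExteriorAlgebra R (Module.Dual R F)) = contr (Module.Dual.eval R F w) β := rfl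

theorem coe_contractPow (d : Module.Dual R F) (j : ℤ) (a : ExtPow R F j) :
    (contractPow d j a : ExteriorAlgebra R F) = contr d a := rfl

theorem coe_mapPow (Y : F →ₗ[R] Module.Dual R F) (j : ℤ) (a : ExtPow R F j) :
    (mapPow Y j a : ExteriorAlgebra R (Module.Dual R F)) = ExteriorAlgebra.map Y a := rfl

theorem coe_minor {n : ℕ} (η : ⋀[R]^n F) (Y : F →ₗ[R] Module.Dual R F) (t : ℤ)
    (α : ExtPow R (Module.Dual R F) t) :
    (minor η Y t α : ExteriorAlgebra R F) = minorMap LinearMap.id (η : ExteriorAlgebra R F) Y α :=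
  rfl

theorem coe_minorWedge {n : ℕ} (η : ⋀[R]^n F) (Y : F →ₗ[R] Module.Dual R F) (t : ℤ)
    (α : ExtPow R (Module.Dual R F) t) (d : Module.Dual R F) :
    (minorWedge η Y t α ⟨ExteriorAlgebra.ι R d, ι_mem_Pow _⟩ : ExteriorAlgebra R F) =
      contr d (minorMap LinearMap.id (η : ExteriorAlgebra R F) Y α) := by
  change act LinearMap.id (ExteriorAlgebra.ι R d * ExteriorAlgebra.map Y
    (act LinearMap.id (α : ExteriorAlgebra R (Module.Dual R F)) (η : ExteriorAlgebra R F)))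
    (η : ExteriorAlgebra R F) = _
  rw [act_mul, act_ι_apply]
  rfl

variable {n : ℕ} {e : Fin n → F} {e' : Fin n → Module.Dual R F}

/-- Since `(β₁ ∧ δ)(η) = β₁(δ(η))`, the vector split off from `β` acts as a contraction on `N_Y α`;
summing over the basis gives `K`. -/
theorem incl_minorComul (he' : ∀ y, ∑ i, Module.Dual.eval R F (e i) y • e' i = y) (η : ⋀[R]^n F)
    (Y : F →ₗ[R] Module.Dual R F) (t s : ℤ) (α : ExtPow R (Module.Dual R F) t)
    (β : ExtPow R (Module.Dual R F) s) :
    incl R _ _ (t - 1) (s - 1) (minorComul η Y t s (α ⊗ₜ β)) =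
      koszul LinearMap.id (Module.Dual.eval R F) e e'
        (minorMap LinearMap.id (η : ExteriorAlgebra R F) Y α ⊗ₜ
          (β : ExteriorAlgebra R (Module.Dual R F))) := by
  rw [koszul_tmul]
  simp only [minorComul, LinearMap.comp_apply, TensorProduct.map_tmul, LinearMap.id_apply,
    comulPow_one (e' := fun i => Module.Dual.eval R F (e i)) he', TensorProduct.tmul_sum, map_sum,
    LinearEquiv.coe_coe, TensorProduct.assoc_symm_tmul, TensorProduct.lift.tmul, incl_tmul]
  refine Finset.sum_congr rfl fun i _ => ?_
  exact congrArg₂ _ (coe_minorWedge η Y t α (e' i)) rfl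

theorem incl_mapComul (he : ∀ x, ∑ i, e' i x • e i = x) (Y : F →ₗ[R] Module.Dual R F) (t s : ℤ)
    (a : ExtPow R F t) (β : ExtPow R (Module.Dual R F) s) :
    incl R _ _ (t - 1) (s - 1) (mapComul Y t s (a ⊗ₜ β)) =
      TensorProduct.map (ExteriorAlgebra.map Y).toLinearMap LinearMap.id
        (koszul LinearMap.id (Module.Dual.eval R F) e e'
          ((a : ExteriorAlgebra R F) ⊗ₜ (β : ExteriorAlgebra R (Module.Dual R F)))) := by
  rw [koszul_tmul]
  simp only [mapComul, LinearMap.comp_apply, TensorProduct.map_tmul, LinearMap.id_apply,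
    comulPow_one (e' := e') he, TensorProduct.sum_tmul, map_sum,
    LinearEquiv.coe_coe, TensorProduct.comm_tmul, TensorProduct.assoc_tmul,
    TensorProduct.lift.tmul, incl_tmul]
  refine Finset.sum_congr rfl fun i _ => ?_
  exact congrArg₂ _ rfl (act_ι_apply (Module.Dual.eval R F) (e i) _)

theorem incl_comm (M : Type*) [AddCommGroup M] [Module R M] (t s : ℤ)
    (z : ExtPow R M t ⊗[R] ExtPow R M s) :
    incl R M M s t (TensorProduct.comm R _ _ z) = TensorProduct.comm R _ _ (incl R M M t s z) := by
  induction z using TensorProduct.induction_on with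
  | zero => simp only [map_zero]
  | add x y hx hy => simp only [map_add, hx, hy]
  | tmul x y => rfl

end Comparison

/-! ### The differential, vanishing outside the range, and the complex property -/

section Main

variable {R F : Type*} [CommRing R] [AddCommGroup F] [Module R F] {n : ℕ}

/-- The operators of the merged Koszul complex. -/
abbrev dualOps (u : F) (X : F →ₗ[R] Module.Dual R F) (v : F) (η : ⋀[R]^n F) (e : Fin n → F)
    (e' : Fin n → Module.Dual R F) :=
  ops LinearMap.id (Module.Dual.eval R F) (η : ExteriorAlgebra R F) e e' X X.flip u v

variable {e : Fin n → F} {e' : Fin n → Module.Dual R F}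
  (u : F) (X : F →ₗ[R] Module.Dual R F) (v : F) (η : ⋀[R]^n F)

theorem toUngraded_f1 (he' : ∀ y, ∑ i, Module.Dual.eval R F (e i) y • e' i = y)
    (r t s : ℤ) (h : s + t = r + 1) (z) :
    toUngraded R F (r - 1) (f1 u X v η r t s h z) =
      (dualOps u X v η e e').d₁ (sgn R r) (incl R _ _ t s z) := by
  induction z using TensorProduct.induction_on with
  | zero => simp only [map_zero]
  | add x y hx hy => simp only [map_add, hx, hy]
  | tmul α β =>
    simp only [f1, LinearMap.add_apply, LinearMap.smul_apply, LinearMap.comp_apply, map_add,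
      map_smul, toUngraded_in1, toUngraded_in2, toUngraded_in3, TensorProduct.map_tmul,
      LinearEquiv.coe_coe, TensorProduct.comm_tmul, incl_minorComul he', MergedOps.d₁_apply,
      incl_tmul, LinearMap.id_apply, coe_evalPow, ops, Prod.smul_mk, Prod.mk_add_mk, smul_zero,
      add_zero, zero_add]

theorem toUngraded_f2 (he : ∀ x, ∑ i, e' i x • e i = x)
    (r t s : ℤ) (h : s + t = r) (z) :
    toUngraded R F (r - 1) (f2 u X v r t s h z) =
      (dualOps u X v η e e').d₂ (sgn R r) (incl R _ _ t s z) := by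
  induction z using TensorProduct.induction_on with
  | zero => simp only [map_zero]
  | add x y hx hy => simp only [map_add, hx, hy]
  | tmul a β =>
    simp only [f2, LinearMap.add_apply, LinearMap.smul_apply, LinearMap.comp_apply, map_add,
      map_smul, toUngraded_in1, toUngraded_in2, toUngraded_in4, TensorProduct.map_tmul,
      incl_mapComul he, MergedOps.d₂_apply, incl_tmul, LinearMap.id_apply, coe_evalPow,
      coe_contractPow, coe_mapPow, ops, Prod.smul_mk, Prod.mk_add_mk, smul_zero, add_zero, zero_add,
      sgn_add_one, neg_smul, sub_eq_add_neg, AlgHom.toLinearMap_apply, Prod.neg_mk, neg_zero]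

theorem toUngraded_f3 (he : ∀ x, ∑ i, e' i x • e i = x)
    (r t s : ℤ) (h : s + t = r) (z) :
    toUngraded R F (r - 1) (f3 u X v r t s h z) =
      (dualOps u X v η e e').d₃ (sgn R r) (incl R _ _ t s z) := by
  induction z using TensorProduct.induction_on with
  | zero => simp only [map_zero]
  | add x y hx hy => simp only [map_add, hx, hy]
  | tmul a β =>
    simp only [f3, LinearMap.add_apply, LinearMap.smul_apply, LinearMap.comp_apply, map_add,
      map_smul, toUngraded_in1, toUngraded_in3, toUngraded_in4, TensorProduct.map_tmul,
      LinearEquiv.coe_coe, TensorProduct.comm_tmul, incl_comm,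
      incl_mapComul he, MergedOps.d₃_apply, incl_tmul, LinearMap.id_apply, coe_evalPow,
      coe_contractPow, coe_mapPow, ops, Prod.smul_mk, Prod.mk_add_mk, smul_zero, add_zero, zero_add,
      sgn_add_one, neg_smul, one_smul, sub_eq_add_neg, AlgHom.toLinearMap_apply, Prod.neg_mk,
      neg_zero]
    exact congrArg (fun w => (_, _, w, _)) (add_comm _ _)

theorem toUngraded_f4 (r t s : ℤ) (h : s + t = r - 1) (z) :
    toUngraded R F (r - 1) (f4 u X v η r t s h z) =
      (dualOps u X v η e e').d₄ (sgn R r) (incl R _ _ t s z) := by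
  induction z using TensorProduct.induction_on with
  | zero => simp only [map_zero]
  | add x y hx hy => simp only [map_add, hx, hy]
  | tmul α β =>
    simp only [f4, LinearMap.add_apply, LinearMap.smul_apply, LinearMap.comp_apply, map_add,
      map_smul, toUngraded_in2, toUngraded_in3, toUngraded_in4, TensorProduct.map_tmul,
      LinearEquiv.coe_coe, TensorProduct.comm_tmul, MergedOps.d₄_apply, coe_minor,
      incl_tmul, LinearMap.id_apply, coe_evalPow, ops, Prod.smul_mk, Prod.mk_add_mk, smul_zero,
      add_zero, zero_add]

theorem comp_toModule_eq {φ : ℤ → Type*} [∀ t, AddCommMonoid (φ t)] [∀ t, Module R (φ t)]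
    {A B C : Type*} [AddCommMonoid A] [Module R A] [AddCommMonoid B] [Module R B]
    [AddCommMonoid C] [Module R C] (J : A →ₗ[R] C) (k : ∀ t, φ t →ₗ[R] A) (D : B →ₗ[R] C)
    (l : ∀ t, φ t →ₗ[R] B) (h : ∀ t z, J (k t z) = D (l t z)) :
    J ∘ₗ DirectSum.toModule R ℤ A k = D ∘ₗ DirectSum.toModule R ℤ B l :=
  DirectSum.linearMap_ext R fun t => LinearMap.ext fun z => by
    simp only [LinearMap.comp_apply, DirectSum.toModule_lof, h]

theorem toUngraded_g1 (he' : ∀ y, ∑ i, Module.Dual.eval R F (e i) y • e' i = y) (r : ℤ)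
    (z : F1 R F r) :
    toUngraded R F (r - 1) (g1 u X v η r z) =
      (dualOps u X v η e e').d₁ (sgn R r) (total R (Module.Dual R F) (Module.Dual R F) (r + 1) z) :=
  LinearMap.congr_fun (comp_toModule_eq (toUngraded R F (r - 1))
    (fun t => f1 u X v η r t (r + 1 - t) (sub_add_cancel _ _))
    ((dualOps u X v η e e').d₁ (sgn R r))
    (fun t => incl R (Module.Dual R F) (Module.Dual R F) t (r + 1 - t))
    fun t z => toUngraded_f1 u X v η he' r t (r + 1 - t) (sub_add_cancel _ _) z) z

theorem toUngraded_g2 (he : ∀ x, ∑ i, e' i x • e i = x) (r : ℤ) (z : F2 R F r) :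
    toUngraded R F (r - 1) (g2 u X v r z) =
      (dualOps u X v η e e').d₂ (sgn R r) (total R F (Module.Dual R F) r z) :=
  LinearMap.congr_fun (comp_toModule_eq (toUngraded R F (r - 1))
    (fun t => f2 u X v r t (r - t) (sub_add_cancel _ _))
    ((dualOps u X v η e e').d₂ (sgn R r)) (fun t => incl R F (Module.Dual R F) t (r - t))
    fun t z => toUngraded_f2 u X v η he r t (r - t) (sub_add_cancel _ _) z) z

theorem toUngraded_g3 (he : ∀ x, ∑ i, e' i x • e i = x) (r : ℤ) (z : F3 R F r) :
    toUngraded R F (r - 1) (g3 u X v r z) =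
      (dualOps u X v η e e').d₃ (sgn R r) (total R F (Module.Dual R F) r z) :=
  LinearMap.congr_fun (comp_toModule_eq (toUngraded R F (r - 1))
    (fun t => f3 u X v r t (r - t) (sub_add_cancel _ _))
    ((dualOps u X v η e e').d₃ (sgn R r)) (fun t => incl R F (Module.Dual R F) t (r - t))
    fun t z => toUngraded_f3 u X v η he r t (r - t) (sub_add_cancel _ _) z) z

theorem toUngraded_g4 (r : ℤ) (z : F4 R F r) :
    toUngraded R F (r - 1) (g4 u X v η r z) =
      (dualOps u X v η e e').d₄ (sgn R r) (total R (Module.Dual R F) (Module.Dual R F) (r - 1) z) :=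
  LinearMap.congr_fun (comp_toModule_eq (toUngraded R F (r - 1))
    (fun t => f4 u X v η r t (r - 1 - t) (sub_add_cancel _ _))
    ((dualOps u X v η e e').d₄ (sgn R r))
    (fun t => incl R (Module.Dual R F) (Module.Dual R F) t (r - 1 - t))
    fun t z => toUngraded_f4 u X v η r t (r - 1 - t) (sub_add_cancel _ _) z) z

theorem f_apply (r : ℤ) (z : FF R F r) :
    f u X v η r z =
      g1 u X v η r z.1 + (g2 u X v r z.2.1 + (g3 u X v r z.2.2.1 + g4 u X v η r z.2.2.2)) :=
  rfl

theorem toUngraded_f (he : ∀ x, ∑ i, e' i x • e i = x)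
    (he' : ∀ y, ∑ i, Module.Dual.eval R F (e i) y • e' i = y) (r : ℤ) (z : FF R F r) :
    toUngraded R F (r - 1) (f u X v η r z) =
      (dualOps u X v η e e').d (sgn R r) (toUngraded R F r z) := by
  have h : toUngraded R F (r - 1) (f u X v η r z) =
      toUngraded R F (r - 1) (g1 u X v η r z.1) + (toUngraded R F (r - 1) (g2 u X v r z.2.1) +
        (toUngraded R F (r - 1) (g3 u X v r z.2.2.1) +
          toUngraded R F (r - 1) (g4 u X v η r z.2.2.2))) := by
    rw [f_apply, map_add, map_add, map_add]
  refine h.trans (Eq.trans (congrArg₂ (· + ·) (toUngraded_g1 u X v η he' r z.1)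
    (congrArg₂ (· + ·) (toUngraded_g2 u X v η he r z.2.1)
      (congrArg₂ (· + ·) (toUngraded_g3 u X v η he r z.2.2.1)
        (toUngraded_g4 (e := e) (e' := e') u X v η r z.2.2.2)))) ?_)
  exact (MergedOps.d_apply (O := dualOps u X v η e e') (s := sgn R r) (toUngraded R F r z)).symm

theorem coe_Pow_eq_zero {M : Type*} [AddCommGroup M] [Module R M] (b : Module.Basis (Fin n) R M)
    {k : ℤ} (hk : k < 0 ∨ n < k) (x : ExtPow R M k) : x = 0 :=
  Subtype.ext <| hk.elim (fun hk => eq_zero_of_mem_Pow_neg hk x.2)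
    fun hk => eq_zero_of_mem_Pow_gt b hk x.2

theorem subsingleton_tensor {M N : Type*} [AddCommGroup M] [Module R M] [AddCommGroup N]
    [Module R N] (b : Module.Basis (Fin n) R M) (b' : Module.Basis (Fin n) R N) {t s : ℤ}
    (h : s + t < 0 ∨ 2 * (n : ℤ) < s + t) : Subsingleton (ExtPow R M t ⊗[R] ExtPow R N s) := by
  have h0 : ∀ z : ExtPow R M t ⊗[R] ExtPow R N s, z = 0 := by
    intro z
    induction z using TensorProduct.induction_on with
    | zero => rfl
    | add x y hx hy => rw [hx, hy, add_zero]
    | tmul x y =>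
      rcases (by lia : (t < 0 ∨ n < t) ∨ (s < 0 ∨ n < s)) with h | h
      · rw [coe_Pow_eq_zero b h x, TensorProduct.zero_tmul]
      · rw [coe_Pow_eq_zero b' h y, TensorProduct.tmul_zero]
  exact ⟨fun x y => (h0 x).trans (h0 y).symm⟩

theorem subsingleton_FF (b : Module.Basis (Fin n) R F) {r : ℤ}
    (hr : r < -1 ∨ 2 * (n : ℤ) + 1 < r) : Subsingleton (FF R F r) := by
  -- The total degrees of the four summands are `r + 1`, `r`, `r`, `r - 1`, and a summand vanishes
  -- unless its total degree lies in `[0, 2n]`. The first summand determines the lower bound on `r`,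
  -- the fourth the upper one.
  have h1 : Subsingleton (F1 R F r) := by
    have := fun t : ℤ => subsingleton_tensor b.dualBasis b.dualBasis (t := t) (s := r + 1 - t)
      (by lia)
    exact inferInstanceAs (Subsingleton (Π₀ t, _))
  have h2 : Subsingleton (F2 R F r) := by
    have := fun t : ℤ => subsingleton_tensor b b.dualBasis (t := t) (s := r - t) (by lia)
    exact inferInstanceAs (Subsingleton (Π₀ t, _))
  have h3 : Subsingleton (F3 R F r) := h2
  have h4 : Subsingleton (F4 R F r) := by
    have := fun t : ℤ => subsingleton_tensor b.dualBasis b.dualBasis (t := t) (s := r - 1 - t)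
      (by lia)
    exact inferInstanceAs (Subsingleton (Π₀ t, _))
  infer_instance

theorem f_comp_f (b : Module.Basis (Fin n) R F) (ε : ⋀[R]^n (Module.Dual R F))
    (hηε : act (Module.Dual.eval R F) (η : ExteriorAlgebra R F)
      (ε : ExteriorAlgebra R (Module.Dual R F)) = 1) (r : ℤ) :
    f u X v η (r - 1) ∘ₗ f u X v η r = 0 := by
  have he : ∀ x, ∑ i, b.coord i x • b i = x := fun x => b.sum_repr x
  have he' : ∀ y, ∑ i, Module.Dual.eval R F (b i) y • b.coord i = y := fun y =>
    b.ext fun j => by simp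
  have hrel := ops_relations (P := (LinearMap.id : Module.Dual R F →ₗ[R] Module.Dual R F))
    (Q := Module.Dual.eval R F) rfl η.2 (ι_mul_top b η.2) (ι_mul_top b.dualBasis ε.2) hηε
    (e := b) (e' := b.coord) he he' (X := X) (Z := X.flip) (fun _ => rfl) (fun _ => rfl) u v
  -- After the embedding, `f` at `r` and at `r - 1` become the same formal differential with
  -- opposite signs.
  refine LinearMap.ext fun z => toUngraded_injective (r - 1 - 1) ?_
  rw [LinearMap.comp_apply, toUngraded_f u X v η he he', toUngraded_f u X v η he he', sgn_sub_one,
    MergedOps.d_neg_d hrel (sgn_eq_one_or r), LinearMap.zero_apply, map_zero]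

theorem exists_basis_fin_or_subsingleton [Module.Free R F] [Module.Finite R F]
    (hF : Module.rank R F = n) :
    Subsingleton R ∨ Nonempty (Module.Basis (Fin n) R F) := by
  rcases subsingleton_or_nontrivial R with h | h
  · exact Or.inl h
  · exact Or.inr ⟨Module.finBasisOfFinrankEq R F (Module.finrank_eq_of_rank_eq hF)⟩

end Main

end MergedKoszul

end

theorem proposition2p2 {R F : Type*} [CommRing R] [IsNoetherianRing R]
    [AddCommGroup F] [Module R F] [Module.Free R F] [Module.Finite R F]
    (n : ℕ) (hn : 2 ≤ n) (hF : Module.rank R F = n)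
    (u : F) (X : F →ₗ[R] Module.Dual R F) (v : F)
    (η : ⋀[R]^n F) (ε : ⋀[R]^n (Module.Dual R F))
    (hηε : MergedKoszul.act (Module.Dual.eval R F) (η : ExteriorAlgebra R F)
      (ε : ExteriorAlgebra R (Module.Dual R F)) = 1) :
    (∀ r : ℤ, r < -1 ∨ 2 * (n : ℤ) + 1 < r → Subsingleton (MergedKoszul.FF R F r)) ∧
      ∀ r : ℤ, MergedKoszul.f u X v η (r - 1) ∘ₗ MergedKoszul.f u X v η r = 0 := by
  -- Over the zero ring every module is trivial and both claims are immediate; otherwise the rank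
  -- provides a basis indexed by `Fin n`.
  rcases MergedKoszul.exists_basis_fin_or_subsingleton hF with h | ⟨⟨b⟩⟩
  · have hsub : ∀ r, Subsingleton (MergedKoszul.FF R F r) := fun r => Module.subsingleton R _
    exact ⟨fun r _ => hsub r, fun r => LinearMap.ext fun z => (hsub _).elim _ _⟩
  · exact ⟨fun r hr => MergedKoszul.subsingleton_FF b hr,
      fun r => MergedKoszul.f_comp_f u X v η b ε hηε r⟩
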